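/- Let $0<d<\pi/2$ and $\mathscr{D}_d=\{\zeta\in\mathbb{C}:|\operatorname{Im}\zeta|<d\}$, $\mathscr{D}_d^-=\{\zeta\in\mathscr{D}_d:\operatorname{Re}\zeta<0\}$, $\mathscr{D}_d^+=\{\zeta\in\mathscr{D}_d:\operatorname{Re}\zeta\ge 0\}$. Let $\psi(\zeta)=\sinh\left(\frac{\pi}{2}\sinh\zeta\right)$, and let $\psi^{-1}:\mathbb{R}\to\mathbb{R}$ denote the inverse of its restriction $\psi:\mathbb{R}\to\mathbb{R}$. For $\gamma>0$ put $E_1(z;\gamma)=(1+z^2)^{-(\gamma+1)/2}$ and $$x_\gamma=\begin{cases}\operatorname{arcsinh}\left(\dfrac{\sqrt{1+\sqrt{1-(2\pi\gamma)^2}}}{2\pi\gamma}\right)&\text{if }0<\gamma<1/(2\pi),\\[2mm] \operatorname{arcsinh}(1)&\text{if }\gamma\ge 1/(2\pi).\end{cases}$$ For $h>0$ and $k\in\mathbb{Z}$ let $$J(k,h)(x)=h\left\{\frac12+\frac1\pi\operatorname{Si}\left[\pi\left(\frac{x}{h}-k\right)\right]\right\},\qquad \operatorname{Si}(x)=\int_0^x\frac{\sin\sigma}{\sigma}\,d\sigma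 .$$ **Theorem.** Assume that $f$ is analytic in $\psi(\mathscr{D}_d)$ and that there are positive constants $K,\alpha,\beta$ such that $|f(z)|\le K|E_1(z;\alpha)|$ for all $z\in\psi(\mathscr{D}_d^-)$ and $|f(z)|\le K|E_1(z;\beta)|$ for all $z\in\psi(\mathscr{D}_d^+)$. Let $\mu=\min\{\alpha,\beta\}$, $\nu=\max\{\alpha,\beta\}$, let $n$ be a positive integer, let $$h=\frac{\log(4dn/\mu)}{n},$$ and let $$\begin{cases}M=n,\quad N=n-\lfloor\log(\beta/\alpha)/h\rfloor&\text{if }\mu=\alpha,\\ N=n,\quad M=n-\lfloor\log(\alpha/\beta)/h\rfloor&\text{if }\mu=\beta.\end{cases}$$ Suppose that $n$ is so large that $n\ge \nu e/(4d)$, $Mh\ge x_{\alpha/2}$ and $Nh\ge x_{\beta/2}$. Then $f$ is integrable on $\mathbb{R}$ and $$\sup_{\tau\in\mathbb{R}}\left|\int_{-\infty}^{\tau}f(t)\,dt-\sum_{k=-M}^{N}f(\psi(kh))\,\psi'(kh)\,J(k,h)(\psi^{-1}(\tau))\right|\le C_1\,\frac{\log(4dn/\mu)}{n}\,e^{-\pi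 dn/\log(4dn/\mu)},$$ where the constant $C_1$, independent of $n$, is $$C_1=\frac{2^{\nu+1}K}{\mu d}\left\{\frac{1}{\left(1-e^{-\pi\mu e/2}\right)\left\{\cos\left(\frac{\pi}{2}\sin d\right)\right\}^{\nu}\cos d}+e^{\pi(\alpha+\beta)/4}\right\}.$$ -/

import Mathlib

noncomputable section

namespace SincDE

/-- The open strip of half-width `d` around the real axis. -/
def strip (d : ℝ) : Set ℂ := {ζ : ℂ | |ζ.im| < d}

/-- The part of the strip with negative real part. -/
def stripNeg (d : ℝ) : Set ℂ := {ζ : ℂ | ζ ∈ strip d ∧ ζ.re < 0}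

/-- The part of the strip with nonnegative real part. -/
def stripPos (d : ℝ) : Set ℂ := {ζ : ℂ | ζ ∈ strip d ∧ 0 ≤ ζ.re}

/-- The double-exponential transformation `ψ(ζ) = sinh((π/2) sinh ζ)` on the complex plane. -/
def psi (ζ : ℂ) : ℂ := Complex.sinh ((Real.pi / 2 : ℂ) * Complex.sinh ζ)

/-- The inverse of the restriction `ψ : ℝ → ℝ`. -/
def psiInv (τ : ℝ) : ℝ := Real.arsinh (2 / Real.pi * Real.arsinh τ)

theorem psi_psiInv (τ : ℝ) : psi (psiInv τ : ℂ) = (τ : ℂ) := by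
  have h : Real.pi / 2 * (2 / Real.pi * Real.arsinh τ) = Real.arsinh τ := by
    field_simp
  have h2 : Real.sinh (Real.pi / 2 * Real.sinh (psiInv τ)) = τ := by
    rw [psiInv, Real.sinh_arsinh, h, Real.sinh_arsinh]
  rw [psi]
  exact_mod_cast congrArg (fun x : ℝ => (x : ℂ)) h2

theorem psiInv_unique (x τ : ℝ) (h : psi (x : ℂ) = (τ : ℂ)) : psiInv τ = x := by
  have h1 : Real.sinh (Real.pi / 2 * Real.sinh x) = τ := by
    rw [psi] at h
    exact_mod_cast h
  have h2 : 2 / Real.pi * (Real.pi / 2 * Real.sinh x) = Real.sinh x := by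
    field_simp
  rw [psiInv, ← h1, Real.arsinh_sinh, h2, Real.arsinh_sinh]

/-- `E₁(z; γ) = 1 / (1 + z²)^((γ+1)/2)`. Only its modulus is used, which does not depend on
the branch of the power. -/
def E1 (z : ℂ) (γ : ℝ) : ℂ := 1 / (1 + z ^ 2) ^ (((γ + 1) / 2 : ℝ) : ℂ)

/-- The sine integral `Si(x) = ∫₀ˣ sin σ / σ dσ`. -/
def Si (x : ℝ) : ℝ := ∫ σ in (0 : ℝ)..x, Real.sin σ / σ

/-- The basis function `J(k,h)` of the Sinc indefinite integration. -/
def J (k : ℤ) (h x : ℝ) : ℝ := h * (1 / 2 + 1 / Real.pi * Si (Real.pi * (x / h - k)))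

/-- The threshold `x_γ`. -/
def xThreshold (γ : ℝ) : ℝ :=
  if γ < 1 / (2 * Real.pi) then
    Real.arsinh (√(1 + √(1 - (2 * Real.pi * γ) ^ 2)) / (2 * Real.pi * γ))
  else Real.arsinh 1

/-- The lower truncation index `M`. -/
def indexM (α β h : ℝ) (n : ℕ) : ℤ :=
  if min α β = α then (n : ℤ) else (n : ℤ) - ⌊Real.log (α / β) / h⌋

/-- The upper truncation index `N`. -/
def indexN (α β h : ℝ) (n : ℕ) : ℤ :=
  if min α β = α then (n : ℤ) - ⌊Real.log (β / α) / h⌋ else (n : ℤ)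

/-- The rate `exp(-π d n / log(4 d n / μ)) log(4 d n / μ) / n`. -/
def rate (d μ : ℝ) (n : ℕ) : ℝ :=
  Real.exp (-(Real.pi * d * n / Real.log (4 * d * n / μ))) * Real.log (4 * d * n / μ) / n

/-- The explicit error constant. -/
def C1 (K d α β : ℝ) : ℝ :=
  2 ^ (max α β + 1) * K / (min α β * d) *
    (1 / ((1 - Real.exp (-(Real.pi * min α β * Real.exp 1 / 2))) *
        Real.cos (Real.pi / 2 * Real.sin d) ^ max α β * Real.cos d) +
      Real.exp (Real.pi * (α + β) / 4))

end SincDE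

end

namespace SincDE

open MeasureTheory Filter Topology Set

/-! ### The sine integral and the basis functions -/

theorem abs_Si_sub_le {T : ℝ} (hT : 0 < T) : |Si T - Real.pi / 2| ≤ 1 / T := by
  -- With 1/x = ∫₀^∞ exp(-xs) ds and Fubini, Si T becomes the integral of 1/(1+s²), which is π/2,
  -- minus a remainder whose integrand is at most exp(-Ts).
  set G : ℝ → ℝ → ℝ := fun x s => Real.sin x * Real.exp (-(x * s)) with hG
  have hGc : Continuous (Function.uncurry G) := by
    simp only [hG, Function.uncurry_def]; fun_prop
  have hexp : ∀ x : ℝ, 0 < x → IntegrableOn (fun s : ℝ => Real.exp (-(x * s))) (Ioi 0) := by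
    intro x hx
    simpa [neg_mul] using exp_neg_integrableOn_Ioi 0 hx
  have hexpI : ∀ x : ℝ, 0 < x → ∫ s in Ioi (0 : ℝ), Real.exp (-(x * s)) = 1 / x := by
    intro x hx
    have := integral_exp_mul_Ioi (a := -x) (by linarith) 0
    simp only [neg_mul, mul_zero, Real.exp_zero] at this
    rw [this, neg_div_neg_eq]
  have hSi : Si T = ∫ x in Ioc 0 T, ∫ s in Ioi (0 : ℝ), G x s := by
    rw [Si, intervalIntegral.integral_of_le hT.le]
    refine setIntegral_congr_fun measurableSet_Ioc fun x hx => ?_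
    simp only [hG]
    rw [integral_const_mul, hexpI x hx.1, mul_one_div]
  have hint : Integrable (Function.uncurry G)
      ((volume.restrict (Ioc 0 T)).prod (volume.restrict (Ioi (0 : ℝ)))) := by
    rw [integrable_prod_iff hGc.aestronglyMeasurable]
    constructor
    · filter_upwards [ae_restrict_mem measurableSet_Ioc] with x hx
      exact Integrable.const_mul (hexp x hx.1) (Real.sin x)
    -- The s-integral of |G x s| is |sinc x|, which is bounded.
    · have : IntegrableOn (fun x => |Real.sinc x|) (Ioc 0 T) :=
        ((Real.continuous_sinc.abs).integrableOn_Icc).mono_set Ioc_subset_Icc_self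
      refine this.congr ?_
      filter_upwards [ae_restrict_mem measurableSet_Ioc] with x hx
      simp only [hG, Function.uncurry_apply_pair, norm_mul, Real.norm_eq_abs, Real.abs_exp]
      rw [integral_const_mul, hexpI x hx.1, Real.sinc_of_ne_zero hx.1.ne', abs_div,
        abs_of_pos hx.1, mul_one_div]
  have hinner : ∀ s : ℝ, ∫ x in Ioc 0 T, G x s = (1 + s ^ 2)⁻¹ -
      Real.exp (-(T * s)) * (s * Real.sin T + Real.cos T) / (1 + s ^ 2) := by
    intro s
    have hs : (1 + s ^ 2) ≠ 0 := by positivity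
    rw [← intervalIntegral.integral_of_le hT.le]
    have hd : ∀ x ∈ uIcc 0 T, HasDerivAt
        (fun x => -(Real.exp (-(x * s)) * (s * Real.sin x + Real.cos x) / (1 + s ^ 2))) (G x s) x := by
      intro x _
      have h1 : HasDerivAt (fun x => Real.exp (-(x * s))) (Real.exp (-(x * s)) * (-(1 * s))) x :=
        (((hasDerivAt_id x).mul_const s).neg).exp
      have h2 : HasDerivAt (fun x => s * Real.sin x + Real.cos x)
          (s * Real.cos x + -Real.sin x) x :=
        ((Real.hasDerivAt_sin x).const_mul s).add (Real.hasDerivAt_cos x)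
      refine ((h1.mul h2).div_const (1 + s ^ 2)).neg.congr_deriv ?_
      simp only [hG]
      field_simp
      ring
    rw [intervalIntegral.integral_eq_sub_of_hasDerivAt hd]
    · simp; ring
    · exact (by simp only [hG]; fun_prop : Continuous fun x => G x s).intervalIntegrable _ _
  have hswap : Si T = ∫ s in Ioi (0 : ℝ), ((1 + s ^ 2)⁻¹ -
      Real.exp (-(T * s)) * (s * Real.sin T + Real.cos T) / (1 + s ^ 2)) := by
    rw [hSi, integral_integral_swap hint]
    simp only [hinner]
  have hbd : ∀ s : ℝ, ‖Real.exp (-(T * s)) * (s * Real.sin T + Real.cos T) / (1 + s ^ 2)‖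
      ≤ Real.exp (-(T * s)) := by
    intro s
    have hs : 0 < 1 + s ^ 2 := by positivity
    rw [norm_div, norm_mul, Real.norm_eq_abs, Real.abs_exp, Real.norm_eq_abs, Real.norm_eq_abs,
      abs_of_pos hs, div_le_iff₀ hs]
    refine mul_le_mul_of_nonneg_left ?_ (Real.exp_pos _).le
    refine abs_le_of_sq_le_sq ?_ hs.le
    -- Cauchy–Schwarz: (s sin T + cos T)² ≤ 1 + s² ≤ (1 + s²)².
    nlinarith [Real.sin_sq_add_cos_sq T, sq_nonneg (s * Real.cos T - Real.sin T), sq_nonneg s]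
  have hr : IntegrableOn (fun s : ℝ =>
      Real.exp (-(T * s)) * (s * Real.sin T + Real.cos T) / (1 + s ^ 2)) (Ioi 0) := by
    refine (hexp T hT).mono' ?_ (ae_of_all _ hbd)
    refine Continuous.aestronglyMeasurable ?_
    exact Continuous.div (by fun_prop) (by fun_prop) fun s => by positivity
  rw [integral_sub integrable_inv_one_add_sq.integrableOn hr, integral_Ioi_inv_one_add_sq] at hswap
  rw [hswap, Real.arctan_zero, sub_zero, sub_sub_cancel_left, abs_neg, ← hexpI T hT,
    ← Real.norm_eq_abs]
  exact norm_integral_le_of_norm_le (hexp T hT) (ae_of_all _ hbd)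

/-- At σ = 0 the quotient sin σ / σ takes the default value 0 while `Real.sinc` is 1; a single point
does not affect the integral. -/
theorem Si_eq_integral_sinc (x : ℝ) : Si x = ∫ σ in (0 : ℝ)..x, Real.sinc σ := by
  rw [Si]
  refine intervalIntegral.integral_congr_ae ?_
  have : ∀ᵐ σ : ℝ, σ ≠ 0 := by simp [ae_iff]
  filter_upwards [this] with σ hσ _
  rw [Real.sinc_of_ne_zero hσ]

theorem Si_neg (x : ℝ) : Si (-x) = -Si x := by
  have := intervalIntegral.integral_comp_neg (f := Real.sinc) (a := 0) (b := x)
  simp only [Real.sinc_neg, neg_zero] at this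
  rw [Si_eq_integral_sinc, Si_eq_integral_sinc, this, intervalIntegral.integral_symm]

theorem hasDerivAt_Si (x : ℝ) : HasDerivAt Si (Real.sinc x) x := by
  have : Si = fun x => ∫ σ in (0 : ℝ)..x, Real.sinc σ := funext Si_eq_integral_sinc
  rw [this]
  exact intervalIntegral.integral_hasDerivAt_right (Real.continuous_sinc.intervalIntegrable _ _)
    (Real.continuous_sinc.stronglyMeasurableAtFilter _ _) Real.continuous_sinc.continuousAt

/-- For 0 ≤ x ≤ 1 the integrand is at most 1, and for x > 1 the bound π/2 + 1/x ≤ π applies. This is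
crude, but the resulting |J| ≤ 3h/2 fits the stated constant. -/
theorem abs_Si_le_pi (x : ℝ) : |Si x| ≤ Real.pi := by
  have key : ∀ x : ℝ, 0 ≤ x → |Si x| ≤ Real.pi := by
    intro x hx
    rcases le_or_gt x 1 with h1 | h1
    · have := intervalIntegral.norm_integral_le_of_norm_le_const (a := 0) (b := x) (C := 1)
        (f := Real.sinc) fun y _ => Real.abs_sinc_le_one y
      rw [← Si_eq_integral_sinc, Real.norm_eq_abs, sub_zero, abs_of_nonneg hx] at this
      linarith [Real.pi_gt_three]
    · have h2 := abs_Si_sub_le (by linarith : 0 < x)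
      have h3 : 1 / x ≤ 1 := by rw [div_le_one (by linarith)]; linarith
      have h4 := abs_le.mp h2
      rw [abs_le]
      constructor <;> linarith [Real.pi_gt_three]
  rcases le_total 0 x with hx | hx
  · exact key x hx
  · have := key (-x) (by linarith)
    rwa [Si_neg, abs_neg] at this

theorem tendsto_Si_atTop : Tendsto Si atTop (𝓝 (Real.pi / 2)) := by
  rw [tendsto_iff_norm_sub_tendsto_zero]
  refine squeeze_zero' (Eventually.of_forall fun _ => norm_nonneg _) ?_
    tendsto_inv_atTop_zero
  filter_upwards [eventually_gt_atTop 0] with x hx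
  rw [← one_div]
  exact abs_Si_sub_le hx

theorem tendsto_Si_atBot : Tendsto Si atBot (𝓝 (-(Real.pi / 2))) := by
  have := (tendsto_Si_atTop.comp tendsto_neg_atBot_atTop).neg
  refine this.congr fun x => ?_
  simp [Si_neg]

theorem abs_J_le (k : ℤ) {h : ℝ} (hh : 0 < h) (x : ℝ) : |J k h x| ≤ 3 / 2 * h := by
  rw [J, abs_mul, abs_of_pos hh, mul_comm]
  refine mul_le_mul_of_nonneg_right ?_ hh.le
  refine (abs_add_le _ _).trans ?_
  rw [abs_mul, abs_of_pos (by positivity : (0 : ℝ) < 1 / Real.pi),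
    abs_of_pos (by norm_num : (0 : ℝ) < 1 / 2)]
  have := mul_le_mul_of_nonneg_left (abs_Si_le_pi (Real.pi * (x / h - k)))
    (by positivity : (0 : ℝ) ≤ 1 / Real.pi)
  rw [one_div_mul_cancel Real.pi_ne_zero] at this
  linarith

/-- The summand 1/2 in J normalizes the antiderivative of the sinc function to vanish at -∞. -/
theorem tendsto_J_atBot (k : ℤ) {h : ℝ} (hh : 0 < h) : Tendsto (J k h) atBot (𝓝 0) := by
  have h1 : Tendsto (fun x : ℝ => Real.pi * (x / h - k)) atBot atBot := by
    refine Tendsto.const_mul_atBot Real.pi_pos ?_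
    exact tendsto_atBot_add_const_right _ _ (tendsto_id.atBot_div_const hh)
  have h2 := (((tendsto_Si_atBot.comp h1).const_mul (1 / Real.pi)).const_add (1 / 2)).const_mul h
  have h3 : h * (1 / 2 + 1 / Real.pi * -(Real.pi / 2)) = 0 := by
    field_simp; ring
  rw [h3] at h2
  exact h2

theorem hasDerivAt_J (k : ℤ) {h : ℝ} (hh : 0 < h) (x : ℝ) :
    HasDerivAt (J k h) (Real.sinc (Real.pi * (x / h - k))) x := by
  have h1 : HasDerivAt (fun x : ℝ => Real.pi * (x / h - k)) (Real.pi * (1 / h)) x :=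
    (((hasDerivAt_id x).div_const h).sub_const _).const_mul _
  have h2 := ((((hasDerivAt_Si _).comp x h1).const_mul (1 / Real.pi)).const_add (1 / 2)).const_mul h
  refine h2.congr_deriv ?_
  field_simp

theorem integral_sinc_eq_J_sub (k : ℤ) {h : ℝ} (hh : 0 < h) (a b : ℝ) :
    ∫ x in a..b, Real.sinc (Real.pi * (x / h - k)) = J k h b - J k h a := by
  refine intervalIntegral.integral_eq_sub_of_hasDerivAt (fun x _ => hasDerivAt_J k hh x) ?_
  exact (Real.continuous_sinc.comp (by fun_prop)).intervalIntegrable _ _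

/-! ### Cauchy's theorem on rectangles -/

/-- The integral of `f` along the boundary of the rectangle `[a, b] × [-c, c]`. -/
noncomputable def rectIntegral (f : ℂ → ℂ) (a b c : ℝ) : ℂ :=
  (∫ x : ℝ in a..b, f (x + ((-c : ℝ) : ℂ) * Complex.I)) - (∫ x : ℝ in a..b, f (x + c * Complex.I)) +
    Complex.I * (∫ y : ℝ in (-c)..c, f (b + y * Complex.I)) -
    Complex.I * (∫ y : ℝ in (-c)..c, f (a + y * Complex.I))

/-- The boundary of the rectangle `[a, b] × [-c, c]`. -/
def rectBoundary (a b c : ℝ) : Set ℂ :=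
  {z | z ∈ Icc a b ×ℂ Icc (-c) c ∧ (z.re = a ∨ z.re = b ∨ z.im = -c ∨ z.im = c)}

section Rect

variable {a b c : ℝ}

theorem mem_rectBoundary_bottom (hc : 0 ≤ c) {x : ℝ} (hx : x ∈ Icc a b) :
    (x + ((-c : ℝ) : ℂ) * Complex.I) ∈ rectBoundary a b c := by
  constructor
  · rw [Complex.mem_reProdIm]
    simpa [hc] using hx
  · simp

theorem mem_rectBoundary_top (hc : 0 ≤ c) {x : ℝ} (hx : x ∈ Icc a b) :
    (x + (c : ℂ) * Complex.I) ∈ rectBoundary a b c := by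
  constructor
  · rw [Complex.mem_reProdIm]
    simpa [hc] using hx
  · simp

theorem mem_rectBoundary_left (hab : a ≤ b) {y : ℝ} (hy : y ∈ Icc (-c) c) :
    (a + (y : ℂ) * Complex.I) ∈ rectBoundary a b c := by
  constructor
  · rw [Complex.mem_reProdIm]
    simpa [hab] using hy
  · simp

theorem mem_rectBoundary_right (hab : a ≤ b) {y : ℝ} (hy : y ∈ Icc (-c) c) :
    (b + (y : ℂ) * Complex.I) ∈ rectBoundary a b c := by
  constructor
  · rw [Complex.mem_reProdIm]
    simpa [hab] using hy
  · simp

theorem rectIntegral_congr (hab : a ≤ b) (hc : 0 ≤ c) {f g : ℂ → ℂ}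
    (h : ∀ z ∈ rectBoundary a b c, f z = g z) : rectIntegral f a b c = rectIntegral g a b c := by
  have hcc : -c ≤ c := by linarith
  unfold rectIntegral
  congr 1
  · congr 1
    · congr 1 <;> refine intervalIntegral.integral_congr fun x hx => h _ ?_ <;>
        rw [uIcc_of_le hab] at hx
      · exact mem_rectBoundary_bottom hc hx
      · exact mem_rectBoundary_top hc hx
    · congr 1
      refine intervalIntegral.integral_congr fun y hy => h _ ?_
      rw [uIcc_of_le hcc] at hy
      exact mem_rectBoundary_right hab hy
  · congr 1
    refine intervalIntegral.integral_congr fun y hy => h _ ?_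
    rw [uIcc_of_le hcc] at hy
    exact mem_rectBoundary_left hab hy

theorem intervalIntegrable_bottom (hab : a ≤ b) (hc : 0 ≤ c) {f : ℂ → ℂ}
    (hf : ContinuousOn f (rectBoundary a b c)) :
    IntervalIntegrable (fun x : ℝ => f (x + ((-c : ℝ) : ℂ) * Complex.I)) volume a b := by
  refine ContinuousOn.intervalIntegrable ?_
  rw [uIcc_of_le hab]
  exact hf.comp (by fun_prop) fun x hx => mem_rectBoundary_bottom hc hx

theorem intervalIntegrable_top (hab : a ≤ b) (hc : 0 ≤ c) {f : ℂ → ℂ}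
    (hf : ContinuousOn f (rectBoundary a b c)) :
    IntervalIntegrable (fun x : ℝ => f (x + (c : ℂ) * Complex.I)) volume a b := by
  refine ContinuousOn.intervalIntegrable ?_
  rw [uIcc_of_le hab]
  exact hf.comp (by fun_prop) fun x hx => mem_rectBoundary_top hc hx

theorem intervalIntegrable_left (hab : a ≤ b) (hc : 0 ≤ c) {f : ℂ → ℂ}
    (hf : ContinuousOn f (rectBoundary a b c)) :
    IntervalIntegrable (fun y : ℝ => f (a + (y : ℂ) * Complex.I)) volume (-c) c := by
  refine ContinuousOn.intervalIntegrable ?_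
  rw [uIcc_of_le (by linarith)]
  exact hf.comp (by fun_prop) fun x hx => mem_rectBoundary_left hab hx

theorem intervalIntegrable_right (hab : a ≤ b) (hc : 0 ≤ c) {f : ℂ → ℂ}
    (hf : ContinuousOn f (rectBoundary a b c)) :
    IntervalIntegrable (fun y : ℝ => f (b + (y : ℂ) * Complex.I)) volume (-c) c := by
  refine ContinuousOn.intervalIntegrable ?_
  rw [uIcc_of_le (by linarith)]
  exact hf.comp (by fun_prop) fun x hx => mem_rectBoundary_right hab hx

theorem rectIntegral_add_mul (hab : a ≤ b) (hc : 0 ≤ c) {f g : ℂ → ℂ} (w : ℂ)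
    (hf : ContinuousOn f (rectBoundary a b c)) (hg : ContinuousOn g (rectBoundary a b c)) :
    rectIntegral (fun z => f z + w * g z) a b c = rectIntegral f a b c + w * rectIntegral g a b c := by
  unfold rectIntegral
  rw [intervalIntegral.integral_add (intervalIntegrable_bottom hab hc hf)
      ((intervalIntegrable_bottom hab hc hg).const_mul w),
    intervalIntegral.integral_add (intervalIntegrable_top hab hc hf)
      ((intervalIntegrable_top hab hc hg).const_mul w),
    intervalIntegral.integral_add (intervalIntegrable_left hab hc hf)
      ((intervalIntegrable_left hab hc hg).const_mul w),
    intervalIntegral.integral_add (intervalIntegrable_right hab hc hf)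
      ((intervalIntegrable_right hab hc hg).const_mul w)]
  simp only [intervalIntegral.integral_const_mul]
  ring

theorem rectIntegral_adjacent {e : ℝ} (hab : a ≤ b) (hbe : b ≤ e) (hc : 0 ≤ c) {f : ℂ → ℂ}
    (hf : ContinuousOn f (rectBoundary a b c)) (hg : ContinuousOn f (rectBoundary b e c)) :
    rectIntegral f a e c = rectIntegral f a b c + rectIntegral f b e c := by
  unfold rectIntegral
  rw [← intervalIntegral.integral_add_adjacent_intervals (intervalIntegrable_bottom hab hc hf)
      (intervalIntegrable_bottom hbe hc hg),
    ← intervalIntegral.integral_add_adjacent_intervals (intervalIntegrable_top hab hc hf)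
      (intervalIntegrable_top hbe hc hg)]
  ring

/-- A primitive of `(z - p)⁻¹` along the segment `x ↦ u * x + w`. -/
theorem integral_inv_line {s t : ℝ} (u w σ : ℂ) (hσ : σ ≠ 0)
    (h : ∀ x ∈ uIcc s t, σ * (u * x + w) ∈ Complex.slitPlane) :
    u * ∫ x in s..t, (u * (x : ℂ) + w)⁻¹ =
      Complex.log (σ * (u * t + w)) - Complex.log (σ * (u * s + w)) := by
  have hne : ∀ x ∈ uIcc s t, u * (x : ℂ) + w ≠ 0 := fun x hx h0 => by
    have := h x hx
    rw [h0, mul_zero] at this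
    exact Complex.slitPlane_ne_zero this rfl
  rw [← intervalIntegral.integral_const_mul]
  refine intervalIntegral.integral_eq_sub_of_hasDerivAt
    (f := fun x : ℝ => Complex.log (σ * (u * x + w))) (fun x hx => ?_) ?_
  · have h1 : HasDerivAt (fun z : ℂ => σ * (u * z + w)) (σ * (u * 1)) (x : ℂ) :=
      (((hasDerivAt_id _).const_mul u).add_const w).const_mul σ
    refine (HasDerivAt.comp_ofReal (h1.clog (h x hx))).congr_deriv ?_
    have := hne x hx
    field_simp
  · refine ContinuousOn.intervalIntegrable fun x hx => ContinuousAt.continuousWithinAt ?_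
    exact continuousAt_const.mul (ContinuousAt.inv₀ (by fun_prop) (hne x hx))

theorem rectIntegral_inv {p : ℝ} (hap : a < p) (hpb : p < b) (hc : 0 < c) :
    rectIntegral (fun z => (z - p)⁻¹) a b c = 2 * Real.pi * Complex.I := by
  have hB := integral_inv_line (s := a) (t := b) 1 (((-c : ℝ) : ℂ) * Complex.I - p) 1 one_ne_zero
    fun x _ => Or.inr (by simpa using hc.ne')
  have hT := integral_inv_line (s := a) (t := b) 1 ((c : ℂ) * Complex.I - p) 1 one_ne_zero
    fun x _ => Or.inr (by simpa using hc.ne')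
  have hR := integral_inv_line (s := -c) (t := c) Complex.I ((b : ℂ) - p) 1 one_ne_zero
    fun x _ => Or.inl (by simpa using hpb)
  -- The left side crosses the cut of the principal logarithm, so log(-w) serves as primitive there.
  -- Converting back to log w at the two left corners produces the 2πi.
  have hL := integral_inv_line (s := -c) (t := c) Complex.I ((a : ℂ) - p) (-1) (by simp)
    fun x _ => Or.inl (by simpa using hap)
  have e1 : ∀ (x : ℝ) (w : ℂ), (x : ℂ) + (w - p) = x + w - p := fun x w => by ring
  have e2 : ∀ (x y : ℝ), Complex.I * (y : ℂ) + ((x : ℂ) - p) = x + y * Complex.I - p :=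
    fun x y => by ring
  simp only [one_mul, e1, e2] at hB hT hR hL
  simp only [rectIntegral]
  rw [hB, hT, hR, hL]
  have hneg : ∀ w : ℂ, 0 < w.im → Complex.log (-w) = Complex.log w - Real.pi * Complex.I := by
    intro w hw
    rw [Complex.log, Complex.log, norm_neg, Complex.arg_neg_eq_arg_sub_pi_of_im_pos hw]
    push_cast; ring
  have hneg' : ∀ w : ℂ, w.im < 0 → Complex.log (-w) = Complex.log w + Real.pi * Complex.I := by
    intro w hw
    rw [Complex.log, Complex.log, norm_neg, Complex.arg_neg_eq_arg_add_pi_of_im_neg hw]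
    push_cast; ring
  rw [neg_one_mul, neg_one_mul, hneg _ (by simpa using hc), hneg' _ (by simpa using hc)]
  ring

/-- The exceptional point p, where only continuity is required, is there for the divided difference
of a function at p. -/
theorem rectIntegral_eq_zero (hab : a ≤ b) (hc : 0 ≤ c) {f : ℂ → ℂ} (p : ℂ)
    (hf : ∀ z ∈ Icc a b ×ℂ Icc (-c) c, ContinuousAt f z)
    (hd : ∀ z ∈ Icc a b ×ℂ Icc (-c) c, z ≠ p → DifferentiableAt ℂ f z) :
    rectIntegral f a b c = 0 := by
  have hcc : -c ≤ c := by linarith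
  have := Complex.integral_boundary_rect_eq_zero_of_differentiable_on_off_countable f
    ⟨a, -c⟩ ⟨b, c⟩ {p} (countable_singleton p)
    (by
      simp only [uIcc_of_le hab, uIcc_of_le hcc]
      exact fun z hz => (hf z hz).continuousWithinAt)
    (by
      simp only [min_eq_left hab, max_eq_right hab, min_eq_left hcc, max_eq_right hcc]
      rintro z ⟨hz, hzp⟩
      rw [Complex.mem_reProdIm] at hz
      exact hd z (by
        rw [Complex.mem_reProdIm]
        exact ⟨Ioo_subset_Icc_self hz.1, Ioo_subset_Icc_self hz.2⟩) hzp)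
  simpa only [rectIntegral, smul_eq_mul] using this

theorem ne_of_mem_rectBoundary {p : ℝ} (hap : a < p) (hpb : p < b) (hc : 0 < c) {z : ℂ}
    (hz : z ∈ rectBoundary a b c) : z ≠ p := by
  rintro rfl
  rcases hz.2 with h | h | h | h <;> simp at h <;> linarith

/-- Cauchy's integral formula for a rectangle and a real point in its interior. -/
theorem rectIntegral_div_sub {p : ℝ} (hap : a < p) (hpb : p < b) (hc : 0 < c) {B : ℂ → ℂ}
    (hB : ∀ z ∈ Icc a b ×ℂ Icc (-c) c, DifferentiableAt ℂ B z) :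
    rectIntegral (fun z => B z / (z - p)) a b c = 2 * Real.pi * Complex.I * B p := by
  have hab : a ≤ b := by linarith
  have hp : (p : ℂ) ∈ Icc a b ×ℂ Icc (-c) c := by
    rw [Complex.mem_reProdIm]
    simp [hap.le, hpb.le, hc.le]
  have hcont : ∀ z ∈ Icc a b ×ℂ Icc (-c) c, ContinuousAt (dslope B p) z := by
    intro z hz
    rcases eq_or_ne z p with rfl | hne
    · exact continuousAt_dslope_same.mpr (hB _ hp)
    · exact (continuousAt_dslope_of_ne hne).mpr (hB z hz).continuousAt
  -- B(z)/(z - p) is the divided difference of B plus B(p)/(z - p); only the second term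
  -- contributes.
  have h0 : rectIntegral (dslope B p) a b c = 0 :=
    rectIntegral_eq_zero hab hc.le p hcont fun z hz hne =>
      (differentiableAt_dslope_of_ne hne).mpr (hB z hz)
  have h1 : ContinuousOn (dslope B p) (rectBoundary a b c) := fun z hz =>
    (hcont z hz.1).continuousWithinAt
  have h2 : ContinuousOn (fun z : ℂ => (z - p)⁻¹) (rectBoundary a b c) :=
    ContinuousOn.inv₀ (by fun_prop) fun z hz =>
      sub_ne_zero.mpr (ne_of_mem_rectBoundary hap hpb hc hz)
  rw [rectIntegral_congr hab hc.le (g := fun z => dslope B p z + B p * (z - p)⁻¹),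
    rectIntegral_add_mul hab hc.le _ h1 h2, h0, rectIntegral_inv hap hpb hc]
  · ring
  · intro z hz
    have hne := ne_of_mem_rectBoundary hap hpb hc hz
    have := sub_ne_zero.mpr hne
    rw [dslope_of_ne _ hne, slope_def_field]
    field_simp
    ring

end Rect

/-! ### Moduli of sine, cosine and hyperbolic cosine -/

theorem norm_sin_sq (z : ℂ) : ‖Complex.sin z‖ ^ 2 = Real.sin z.re ^ 2 + Real.sinh z.im ^ 2 := by
  rw [Complex.sq_norm, Complex.sin_eq, Complex.normSq_apply]
  rw [← Complex.ofReal_sin, ← Complex.ofReal_cos, ← Complex.ofReal_cosh, ← Complex.ofReal_sinh,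
    ← Complex.ofReal_mul, ← Complex.ofReal_mul, Complex.add_re, Complex.add_im,
    Complex.re_ofReal_mul, Complex.im_ofReal_mul]
  simp only [Complex.ofReal_re, Complex.ofReal_im, Complex.I_re, Complex.I_im]
  nlinarith [Real.sin_sq_add_cos_sq z.re, Real.cosh_sq z.im]

theorem norm_cos_sq (z : ℂ) : ‖Complex.cos z‖ ^ 2 = Real.cos z.re ^ 2 + Real.sinh z.im ^ 2 := by
  rw [Complex.sq_norm, Complex.cos_eq, Complex.normSq_apply]
  rw [← Complex.ofReal_sin, ← Complex.ofReal_cos, ← Complex.ofReal_cosh, ← Complex.ofReal_sinh,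
    ← Complex.ofReal_mul, ← Complex.ofReal_mul, Complex.sub_re, Complex.sub_im,
    Complex.re_ofReal_mul, Complex.im_ofReal_mul]
  simp only [Complex.ofReal_re, Complex.ofReal_im, Complex.I_re, Complex.I_im]
  nlinarith [Real.sin_sq_add_cos_sq z.re, Real.cosh_sq z.im]

theorem norm_cosh_sq (z : ℂ) : ‖Complex.cosh z‖ ^ 2 = Real.cos z.im ^ 2 + Real.sinh z.re ^ 2 := by
  rw [← Complex.cos_mul_I, norm_cos_sq]
  simp

theorem norm_cos_le_cosh (z : ℂ) : ‖Complex.cos z‖ ≤ Real.cosh z.im := by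
  refine le_of_sq_le_sq ?_ (Real.cosh_pos _).le
  rw [norm_cos_sq, Real.cosh_sq]
  linarith [Real.cos_sq_le_one z.re]

theorem abs_sinh_im_le_norm_sin (z : ℂ) : |Real.sinh z.im| ≤ ‖Complex.sin z‖ := by
  refine abs_le_of_sq_le_sq ?_ (norm_nonneg _)
  rw [norm_sin_sq]
  linarith [sq_nonneg (Real.sin z.re)]

theorem abs_sin_re_le_norm_sin (z : ℂ) : |Real.sin z.re| ≤ ‖Complex.sin z‖ := by
  refine abs_le_of_sq_le_sq ?_ (norm_nonneg _)
  rw [norm_sin_sq]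
  linarith [sq_nonneg (Real.sinh z.im)]

/-! ### Residues of A(z)/sin(πz/h) at the lattice points -/

section Lattice

variable {h c : ℝ}

theorem pi_mul_div_re (z : ℂ) : (Real.pi * z / h : ℂ).re = Real.pi * z.re / h := by
  rw [Complex.div_ofReal_re, Complex.re_ofReal_mul]

theorem pi_mul_div_im (z : ℂ) : (Real.pi * z / h : ℂ).im = Real.pi * z.im / h := by
  rw [Complex.div_ofReal_im, Complex.im_ofReal_mul]

/-- Halfway between nodes |sin(Re)| = 1, so dividing by the sine costs nothing on vertical sides
placed there. -/
theorem one_le_norm_sin_half (hh : 0 < h) (m : ℤ) {z : ℂ} (hz : z.re = (m + 1 / 2) * h) :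
    1 ≤ ‖Complex.sin (Real.pi * z / h)‖ := by
  refine le_trans ?_ (abs_sin_re_le_norm_sin _)
  rw [pi_mul_div_re, hz, show Real.pi * ((m + 1 / 2) * h) / h = Real.pi / 2 + m * Real.pi by
    field_simp; ring, Real.sin_add_int_mul_pi, abs_mul, abs_zpow]
  simp

/-- The source of exponential convergence: on the horizontal sides the sine is exponentially large
in c/h. -/
theorem sinh_le_norm_sin_line {z : ℂ} (hz : z.im = -c ∨ z.im = c) :
    Real.sinh (Real.pi * c / h) ≤ ‖Complex.sin (Real.pi * z / h)‖ := by
  refine le_trans (le_abs_self _) ?_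
  have h1 := abs_sinh_im_le_norm_sin (Real.pi * z / h)
  rw [pi_mul_div_im] at h1
  rcases hz with hz | hz
  · rwa [hz, mul_neg, neg_div, Real.sinh_neg, abs_neg] at h1
  · rwa [hz] at h1

theorem sinh_pos_line (hh : 0 < h) (hc : 0 < c) : 0 < Real.sinh (Real.pi * c / h) :=
  Real.sinh_pos_iff.mpr (by positivity)

theorem sin_ne_zero_boundary (hh : 0 < h) (hc : 0 < c) {a b : ℤ} {z : ℂ}
    (hz : z ∈ rectBoundary ((a + 1 / 2) * h) ((b + 1 / 2) * h) c) :
    Complex.sin (Real.pi * z / h) ≠ 0 := by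
  rw [← norm_pos_iff]
  have hs := sinh_pos_line hh hc
  rcases hz.2 with h1 | h1 | h1 | h1
  · linarith [one_le_norm_sin_half hh a h1]
  · linarith [one_le_norm_sin_half hh b h1]
  · linarith [sinh_le_norm_sin_line (h := h) (Or.inl h1)]
  · linarith [sinh_le_norm_sin_line (h := h) (Or.inr h1)]

theorem differentiable_sin_pi_mul_div :
    Differentiable ℂ fun z : ℂ => Complex.sin (Real.pi * z / h) := by
  fun_prop

theorem deriv_sin_pi_mul_div (z : ℂ) :
    deriv (fun z : ℂ => Complex.sin (Real.pi * z / h)) z =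
      Complex.cos (Real.pi * z / h) * (Real.pi / h) := by
  have h1 : HasDerivAt (fun z : ℂ => (Real.pi * z / h : ℂ)) (Real.pi * 1 / h) z :=
    ((hasDerivAt_id z).const_mul _).div_const _
  rw [h1.csin.deriv, mul_one]

theorem sin_lattice (hh : h ≠ 0) (k : ℤ) : Complex.sin (Real.pi * ((k * h : ℝ) : ℂ) / h) = 0 := by
  rw [Complex.sin_eq_zero_iff]
  refine ⟨k, ?_⟩
  have : (h : ℂ) ≠ 0 := by exact_mod_cast hh
  push_cast
  field_simp

theorem cos_lattice (hh : h ≠ 0) (k : ℤ) :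
    Complex.cos (Real.pi * ((k * h : ℝ) : ℂ) / h) = (-1) ^ k := by
  have : (h : ℂ) ≠ 0 := by exact_mod_cast hh
  rw [show (Real.pi * ((k * h : ℝ) : ℂ) / h : ℂ) = ((k * Real.pi : ℝ) : ℂ) by
    push_cast; field_simp, ← Complex.ofReal_cos, Real.cos_int_mul_pi]
  push_cast
  rfl

/-- The sine factors as (z - kh) s(z) with s zero-free on the cell, and Cauchy's formula applies to
A/s. Since s(kh) = (-1)^k π/h, the factor 2πi becomes 2ih(-1)^k. -/
theorem rectIntegral_div_sin_cell (hh : 0 < h) (hc : 0 < c) (k : ℤ) {A : ℂ → ℂ}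
    (hA : ∀ z : ℂ, |z.im| ≤ c → DifferentiableAt ℂ A z) :
    rectIntegral (fun z => A z / Complex.sin (Real.pi * z / h)) (((k - 1 : ℤ) + 1 / 2) * h)
      ((k + 1 / 2) * h) c = 2 * Complex.I * h * ((-1) ^ k * A ((k * h : ℝ) : ℂ)) := by
  set p : ℝ := k * h with hp
  have hh' : (h : ℂ) ≠ 0 := by exact_mod_cast hh.ne'
  have hpi : (Real.pi : ℂ) ≠ 0 := by exact_mod_cast Real.pi_ne_zero
  have hap : ((k - 1 : ℤ) + 1 / 2) * h < p := by push_cast; rw [hp]; nlinarith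
  have hpb : p < (k + 1 / 2) * h := by rw [hp]; nlinarith
  set s : ℂ → ℂ := dslope (fun z : ℂ => Complex.sin (Real.pi * z / h)) p with hs
  have hsd : Differentiable ℂ s := by
    rw [← differentiableOn_univ, hs, Complex.differentiableOn_dslope univ_mem]
    exact differentiable_sin_pi_mul_div.differentiableOn
  have hsp : s p = (-1) ^ k * (Real.pi / h) := by
    rw [hs, dslope_same, deriv_sin_pi_mul_div, cos_lattice hh.ne']
  have hmul : ∀ z, (z - p) * s z = Complex.sin (Real.pi * z / h) := by
    intro z
    have := sub_smul_dslope (fun z : ℂ => Complex.sin (Real.pi * z / h)) p z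
    rwa [smul_eq_mul, sin_lattice hh.ne', sub_zero] at this
  have hpow : ((-1 : ℂ)) ^ k ≠ 0 := zpow_ne_zero _ (by norm_num)
  -- A zero of s other than kh would be a lattice point mh with |m - k| ≤ 1/2, which forces m = k.
  have hs0 : ∀ z ∈ Icc (((k - 1 : ℤ) + 1 / 2) * h) ((k + 1 / 2) * h) ×ℂ Icc (-c) c, s z ≠ 0 := by
    intro z hz h0
    rcases eq_or_ne z p with rfl | hne
    · rw [hsp] at h0
      exact mul_ne_zero hpow (div_ne_zero hpi hh') h0
    · have h1 := hmul z
      rw [h0, mul_zero, eq_comm, Complex.sin_eq_zero_iff] at h1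
      obtain ⟨m, hm⟩ := h1
      have hz1 : z = ((m * h : ℝ) : ℂ) := by
        push_cast
        field_simp at hm
        linear_combination hm
      rw [Complex.mem_reProdIm, hz1, Complex.ofReal_re] at hz
      obtain ⟨⟨h2, h3⟩, -⟩ := hz
      have h4 := le_of_mul_le_mul_right h2 hh
      have h5 := le_of_mul_le_mul_right h3 hh
      push_cast at h4
      have h6 : m < k + 1 := by
        have : (m : ℝ) < k + 1 := by linarith
        exact_mod_cast this
      have h7 : k - 1 < m := by
        have : (k : ℝ) - 1 < m := by linarith
        exact_mod_cast this
      have h8 : m = k := by omega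
      exact hne (by rw [hz1, h8])
  rw [rectIntegral_congr (g := fun z => (A z / s z) / (z - p)) (hap.trans hpb).le hc.le,
    rectIntegral_div_sub hap hpb hc, hsp]
  · have : ((-1 : ℂ)) ^ k * (-1) ^ k = 1 := by
      rw [← mul_zpow]; simp
    field_simp
    linear_combination (-(A p)) * this
  · intro z hz
    refine (hA z ?_).div (hsd z) (hs0 z hz)
    exact abs_le.mpr hz.2
  · intro z _
    rw [← hmul z, div_div, mul_comm (z - p : ℂ)]

/-- Cells are glued one at a time. The nodes between (a + 1/2)h and (b + 1/2)h are k = a+1, …, b,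
hence the half-open index interval. -/
theorem rectIntegral_div_sin (hh : 0 < h) (hc : 0 < c) {A : ℂ → ℂ}
    (hA : ∀ z : ℂ, |z.im| ≤ c → DifferentiableAt ℂ A z) {a b : ℤ} (hab : a ≤ b) :
    rectIntegral (fun z => A z / Complex.sin (Real.pi * z / h)) ((a + 1 / 2) * h)
      ((b + 1 / 2) * h) c =
      2 * Complex.I * h * ∑ k ∈ Finset.Ioc a b, (-1) ^ k * A ((k * h : ℝ) : ℂ) := by
  have hmono : ∀ {a b : ℤ}, a ≤ b → ((a : ℝ) + 1 / 2) * h ≤ (b + 1 / 2) * h := by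
    intro a b hab
    have : (a : ℝ) ≤ b := by exact_mod_cast hab
    exact mul_le_mul_of_nonneg_right (by linarith) hh.le
  have hcont : ∀ a b : ℤ, ContinuousOn (fun z => A z / Complex.sin (Real.pi * z / h))
      (rectBoundary ((a + 1 / 2) * h) ((b + 1 / 2) * h) c) := by
    intro a b z hz
    exact ((hA z (abs_le.mpr hz.1.2)).div (differentiable_sin_pi_mul_div z)
      (sin_ne_zero_boundary hh hc hz)).continuousAt.continuousWithinAt
  induction b, hab using Int.leInduction with
  | base => simp [rectIntegral]
  | succ b hab ih =>
    have hcell := rectIntegral_div_sin_cell hh hc (b + 1) hA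
    rw [add_sub_cancel_right] at hcell
    have hset : Finset.Ioc a (b + 1) = insert (b + 1) (Finset.Ioc a b) := by
      ext x; simp only [Finset.mem_Ioc, Finset.mem_insert]; omega
    rw [rectIntegral_adjacent (hmono hab) (hmono (by omega)) hc.le (hcont a b) (hcont b (b + 1)),
      ih, hcell, hset, Finset.sum_insert (by simp)]
    ring

end Lattice

/-! ### From rectangles to strips: the sinc interpolation error -/

/-- The vertical sides have fixed length 2c, so a sup bound tending to zero removes them. -/
theorem tendsto_rectIntegral {f : ℂ → ℂ} {c : ℝ} (hc : 0 ≤ c) {R b : ℕ → ℝ}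
    (hR : Tendsto R atTop atTop) (hb : Tendsto b atTop (𝓝 0))
    (hbot : Integrable fun t : ℝ => f (t + ((-c : ℝ) : ℂ) * Complex.I))
    (htop : Integrable fun t : ℝ => f (t + (c : ℂ) * Complex.I))
    (hv : ∀ n, ∀ y ∈ Icc (-c) c, ‖f (R n + y * Complex.I)‖ ≤ b n ∧
      ‖f ((-R n : ℝ) + y * Complex.I)‖ ≤ b n) :
    Tendsto (fun n => rectIntegral f (-R n) (R n) c) atTop
      (𝓝 ((∫ t : ℝ, f (t + ((-c : ℝ) : ℂ) * Complex.I)) - ∫ t : ℝ, f (t + (c : ℂ) * Complex.I))) := by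
  have hR' : Tendsto (fun n => -R n) atTop atBot := tendsto_neg_atTop_atBot.comp hR
  have h1 := intervalIntegral_tendsto_integral hbot hR' hR
  have h2 := intervalIntegral_tendsto_integral htop hR' hR
  have hcc : -c ≤ c := by linarith
  have hb' : Tendsto (fun n => b n * |c - -c|) atTop (𝓝 0) := by simpa using hb.mul_const _
  have h3 : Tendsto (fun n => ∫ y : ℝ in (-c)..c, f ((R n : ℝ) + y * Complex.I)) atTop (𝓝 0) := by
    refine squeeze_zero_norm (fun n => ?_) hb'
    refine intervalIntegral.norm_integral_le_of_norm_le_const fun y hy => (hv n y ?_).1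
    rw [uIoc_of_le hcc] at hy
    exact Ioc_subset_Icc_self hy
  have h4 : Tendsto (fun n => ∫ y : ℝ in (-c)..c, f ((-R n : ℝ) + y * Complex.I)) atTop (𝓝 0) := by
    refine squeeze_zero_norm (fun n => ?_) hb'
    refine intervalIntegral.norm_integral_le_of_norm_le_const fun y hy => (hv n y ?_).2
    rw [uIoc_of_le hcc] at hy
    exact Ioc_subset_Icc_self hy
  have := ((h1.sub h2).add (h3.const_mul Complex.I)).sub (h4.const_mul Complex.I)
  simpa only [rectIntegral, mul_zero, add_zero, sub_zero] using this

section Strip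

variable {h c : ℝ} {g : ℝ → ℝ}

theorem line_re (t s : ℝ) : (t + (s : ℂ) * Complex.I).re = t := by simp

theorem line_im (t s : ℝ) : (t + (s : ℂ) * Complex.I).im = s := by simp

theorem continuous_line {A : ℂ → ℂ} (hA : ∀ z : ℂ, |z.im| ≤ c → DifferentiableAt ℂ A z) {s : ℝ}
    (hs : |s| ≤ c) : Continuous fun t : ℝ => A (t + (s : ℂ) * Complex.I) := by
  rw [continuous_iff_continuousAt]
  intro t
  refine ContinuousAt.comp (f := fun t : ℝ => (t + (s : ℂ) * Complex.I))
    (hA _ (by rwa [line_im])).continuousAt (by fun_prop)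

theorem integrable_line_mul {A : ℂ → ℂ} (hA : ∀ z : ℂ, |z.im| ≤ c → DifferentiableAt ℂ A z)
    (hAg : ∀ z : ℂ, |z.im| ≤ c → ‖A z‖ ≤ g z.re) (hg : Integrable g) {s : ℝ} (hs : |s| ≤ c)
    {w : ℝ → ℂ} (hw : Continuous w) {C : ℝ} (hC : ∀ t, ‖w t‖ ≤ C) :
    Integrable fun t : ℝ => A (t + (s : ℂ) * Complex.I) * w t := by
  refine (hg.mul_const C).mono' ((continuous_line hA hs).mul hw).aestronglyMeasurable
    (ae_of_all _ fun t => ?_)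
  rw [norm_mul]
  have h1 := hAg (t + (s : ℂ) * Complex.I) (by rwa [line_im])
  rw [line_re] at h1
  exact mul_le_mul h1 (hC t) (norm_nonneg _) ((norm_nonneg _).trans h1)

theorem sin_line_ne_zero (hh : 0 < h) (hc : 0 < c) {s : ℝ} (hs : s = -c ∨ s = c) (t : ℝ) :
    Complex.sin (Real.pi * (t + (s : ℂ) * Complex.I) / h) ≠ 0 := by
  rw [← norm_pos_iff]
  exact (sinh_pos_line hh hc).trans_le (sinh_le_norm_sin_line (by rwa [line_im]))

theorem continuous_inv_sin_line (hh : 0 < h) (hc : 0 < c) {s : ℝ} (hs : s = -c ∨ s = c) :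
    Continuous fun t : ℝ => (Complex.sin (Real.pi * (t + (s : ℂ) * Complex.I) / h))⁻¹ :=
  Continuous.inv₀ (by fun_prop) (sin_line_ne_zero hh hc hs)

theorem norm_inv_sin_line_le (hh : 0 < h) (hc : 0 < c) {s : ℝ} (hs : s = -c ∨ s = c) (t : ℝ) :
    ‖(Complex.sin (Real.pi * (t + (s : ℂ) * Complex.I) / h))⁻¹‖ ≤
      (Real.sinh (Real.pi * c / h))⁻¹ := by
  rw [norm_inv]
  exact inv_anti₀ (sinh_pos_line hh hc) (sinh_le_norm_sin_line (by rwa [line_im]))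

theorem line_sub_ne_zero (hc : 0 < c) {s : ℝ} (hs : s = -c ∨ s = c) (t x : ℝ) :
    (t + (s : ℂ) * Complex.I - x) ≠ 0 := by
  intro h0
  have := congrArg Complex.im h0
  simp at this
  rcases hs with hs | hs <;> linarith

theorem norm_inv_line_sub_le (hc : 0 < c) {s : ℝ} (hs : s = -c ∨ s = c) (t x : ℝ) :
    ‖(t + (s : ℂ) * Complex.I - x)⁻¹‖ ≤ c⁻¹ := by
  rw [norm_inv]
  refine inv_anti₀ hc ?_
  have := Complex.abs_im_le_norm (t + (s : ℂ) * Complex.I - x)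
  simp only [Complex.sub_im, line_im, Complex.ofReal_im, sub_zero] at this
  rcases hs with rfl | rfl
  · rwa [abs_neg, abs_of_pos hc] at this
  · rwa [abs_of_pos hc] at this

theorem abs_eq_of_line (hc : 0 < c) {s : ℝ} (hs : s = -c ∨ s = c) : |s| ≤ c := by
  rcases hs with rfl | rfl
  · rw [abs_neg, abs_of_pos hc]
  · rw [abs_of_pos hc]

theorem integral_div_sin_strip (hh : 0 < h) (hc : 0 < c) {A : ℂ → ℂ}
    (hA : ∀ z : ℂ, |z.im| ≤ c → DifferentiableAt ℂ A z)
    (hAg : ∀ z : ℂ, |z.im| ≤ c → ‖A z‖ ≤ g z.re) (hg : Integrable g)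
    (hg0 : Tendsto g (cocompact ℝ) (𝓝 0)) (hgs : Summable fun k : ℤ => g (k * h)) :
    (∫ t : ℝ, A (t + ((-c : ℝ) : ℂ) * Complex.I) /
        Complex.sin (Real.pi * (t + ((-c : ℝ) : ℂ) * Complex.I) / h)) -
      ∫ t : ℝ, A (t + (c : ℂ) * Complex.I) /
        Complex.sin (Real.pi * (t + (c : ℂ) * Complex.I) / h) =
      2 * Complex.I * h * ∑' k : ℤ, (-1) ^ k * A ((k * h : ℝ) : ℂ) := by
  -- Vertical sides stay midway between poles. The left one, at -(n + 1/2)h, is ((-n-1) + 1/2)h, so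
  -- the nodes enclosed are those of `Finset.Ioc (-n-1) n`.
  set R : ℕ → ℝ := fun n => (n + 1 / 2) * h with hRdef
  have hR : Tendsto R atTop atTop :=
    (tendsto_atTop_add_const_right _ _ tendsto_natCast_atTop_atTop).atTop_mul_const hh
  have hgR : Tendsto (fun n => g (R n)) atTop (𝓝 0) :=
    (hg0.mono_left atTop_le_cocompact).comp hR
  have hgR' : Tendsto (fun n => g (-R n)) atTop (𝓝 0) :=
    (hg0.mono_left atBot_le_cocompact).comp (tendsto_neg_atTop_atBot.comp hR)
  have hb : Tendsto (fun n => max (g (R n)) (g (-R n))) atTop (𝓝 0) := by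
    simpa using hgR.max hgR'
  have hline : ∀ s : ℝ, s = -c ∨ s = c → Integrable fun t : ℝ => A (t + (s : ℂ) * Complex.I) /
      Complex.sin (Real.pi * (t + (s : ℂ) * Complex.I) / h) := fun s hs =>
    integrable_line_mul hA hAg hg (abs_eq_of_line hc hs) (continuous_inv_sin_line hh hc hs)
      (norm_inv_sin_line_le hh hc hs)
  have hvert : ∀ (z : ℂ) (m : ℤ), |z.im| ≤ c → z.re = (m + 1 / 2) * h →
      ‖A z / Complex.sin (Real.pi * z / h)‖ ≤ g z.re := by
    intro z m hz hm
    rw [norm_div]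
    exact (div_le_self (norm_nonneg _) (one_le_norm_sin_half hh m hm)).trans (hAg z hz)
  have hlim := tendsto_rectIntegral (f := fun z => A z / Complex.sin (Real.pi * z / h)) hc.le hR hb
    (hline _ (Or.inl rfl)) (hline _ (Or.inr rfl)) (by
      intro n y hy
      have hy' : |y| ≤ c := abs_le.mpr hy
      constructor
      · refine le_trans ?_ (le_max_left _ _)
        have := hvert (R n + y * Complex.I) n (by rwa [line_im])
          (by rw [line_re, hRdef]; push_cast; rfl)
        rwa [line_re] at this
      · refine le_trans ?_ (le_max_right _ _)
        have := hvert ((-R n : ℝ) + y * Complex.I) (-n - 1) (by rwa [line_im])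
          (by rw [line_re, hRdef]; push_cast; ring)
        rwa [line_re] at this)
  have hsum : Summable fun k : ℤ => (-1 : ℂ) ^ k * A ((k * h : ℝ) : ℂ) := by
    refine Summable.of_norm_bounded hgs fun k => ?_
    rw [norm_mul, norm_zpow, norm_neg, norm_one, one_zpow, one_mul]
    have := hAg ((k * h : ℝ) : ℂ) (by rw [Complex.ofReal_im, abs_zero]; exact hc.le)
    rwa [Complex.ofReal_re] at this
  have hfin : Tendsto (fun n : ℕ => Finset.Ioc (-(n : ℤ) - 1) n) atTop atTop := by
    refine Monotone.tendsto_atTop_finset (fun m n hmn => ?_) fun k => ⟨k.natAbs, ?_⟩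
    · exact Finset.Ioc_subset_Ioc (by omega) (by omega)
    · rw [Finset.mem_Ioc]; omega
  have hlim2 := (hsum.hasSum.comp hfin).const_mul (2 * Complex.I * h)
  refine tendsto_nhds_unique hlim (hlim2.congr fun n => ?_)
  have := rectIntegral_div_sin hh hc hA (a := -(n : ℤ) - 1) (b := n) (by omega)
  simp only [Function.comp_apply]
  rw [← this]
  congr 1
  push_cast [hRdef]
  ring

theorem integral_div_sub_strip (hc : 0 < c) {A : ℂ → ℂ}
    (hA : ∀ z : ℂ, |z.im| ≤ c → DifferentiableAt ℂ A z)
    (hAg : ∀ z : ℂ, |z.im| ≤ c → ‖A z‖ ≤ g z.re) (hg : Integrable g)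
    (hg0 : Tendsto g (cocompact ℝ) (𝓝 0)) (x : ℝ) :
    (∫ t : ℝ, A (t + ((-c : ℝ) : ℂ) * Complex.I) / (t + ((-c : ℝ) : ℂ) * Complex.I - x)) -
      ∫ t : ℝ, A (t + (c : ℂ) * Complex.I) / (t + (c : ℂ) * Complex.I - x) =
      2 * Real.pi * Complex.I * A x := by
  -- This keeps both vertical sides at distance at least 1 from x, so that 1/|z - x| ≤ 1 there.
  set R : ℕ → ℝ := fun n => n + (|x| + 1) with hRdef
  have hR : Tendsto R atTop atTop :=
    tendsto_atTop_add_const_right _ _ tendsto_natCast_atTop_atTop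
  have hgR : Tendsto (fun n => g (R n)) atTop (𝓝 0) :=
    (hg0.mono_left atTop_le_cocompact).comp hR
  have hgR' : Tendsto (fun n => g (-R n)) atTop (𝓝 0) :=
    (hg0.mono_left atBot_le_cocompact).comp (tendsto_neg_atTop_atBot.comp hR)
  have hb : Tendsto (fun n => max (g (R n)) (g (-R n))) atTop (𝓝 0) := by
    simpa using hgR.max hgR'
  have hline : ∀ s : ℝ, s = -c ∨ s = c → Integrable fun t : ℝ => A (t + (s : ℂ) * Complex.I) /
      (t + (s : ℂ) * Complex.I - x) := fun s hs =>
    integrable_line_mul hA hAg hg (abs_eq_of_line hc hs)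
      (Continuous.inv₀ (by fun_prop) fun t => line_sub_ne_zero hc hs t x)
      (norm_inv_line_sub_le hc hs · x)
  have hvert : ∀ z : ℂ, |z.im| ≤ c → 1 ≤ |z.re - x| → ‖A z / (z - x)‖ ≤ g z.re := by
    intro z hz h1
    rw [norm_div]
    refine (div_le_self (norm_nonneg _) (h1.trans ?_)).trans (hAg z hz)
    have := Complex.abs_re_le_norm (z - x)
    rwa [Complex.sub_re, Complex.ofReal_re] at this
  have hx := abs_le.mp (le_refl |x|)
  have hlim := tendsto_rectIntegral (f := fun z => A z / (z - x)) hc.le hR hb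
    (hline _ (Or.inl rfl)) (hline _ (Or.inr rfl)) (by
      intro n y hy
      have hy' : |y| ≤ c := abs_le.mpr hy
      have hn : (0 : ℝ) ≤ n := Nat.cast_nonneg n
      constructor
      · refine le_trans ?_ (le_max_left _ _)
        have := hvert (R n + y * Complex.I) (by rwa [line_im])
          (by rw [line_re, hRdef, le_abs]; left; linarith)
        rwa [line_re] at this
      · refine le_trans ?_ (le_max_right _ _)
        have := hvert ((-R n : ℝ) + y * Complex.I) (by rwa [line_im])
          (by rw [line_re, hRdef, le_abs]; right; linarith)
        rwa [line_re] at this)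
  refine tendsto_nhds_unique hlim (tendsto_const_nhds.congr fun n => ?_)
  have hn : (0 : ℝ) ≤ n := Nat.cast_nonneg n
  rw [rectIntegral_div_sub (by rw [hRdef]; simp only; linarith)
    (by rw [hRdef]; simp only; linarith) hc]
  exact fun z hz => hA z (abs_le.mpr hz.2)

/-- The mean value inequality on the convex strip; it keeps the product of F with this divided
difference under a constant multiple of the majorant of F. -/
theorem norm_dslope_sin_le (hh : 0 < h) (x : ℝ) {z : ℂ} (hz : |z.im| ≤ c) :
    ‖dslope (fun z : ℂ => Complex.sin (Real.pi * z / h)) x z‖ ≤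
      Real.cosh (Real.pi * c / h) * (Real.pi / h) := by
  have hd : ∀ w : ℂ, |w.im| ≤ c → ‖deriv (fun z : ℂ => Complex.sin (Real.pi * z / h)) w‖ ≤
      Real.cosh (Real.pi * c / h) * (Real.pi / h) := by
    intro w hw
    rw [deriv_sin_pi_mul_div, norm_mul]
    have h1 : ‖(Real.pi / h : ℂ)‖ = Real.pi / h := by
      rw [← Complex.ofReal_div, Complex.norm_of_nonneg (by positivity)]
    rw [h1]
    refine mul_le_mul_of_nonneg_right ((norm_cos_le_cosh _).trans ?_) (by positivity)
    rw [pi_mul_div_im, Real.cosh_le_cosh, abs_div, abs_div, abs_mul, abs_mul]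
    exact div_le_div_of_nonneg_right (mul_le_mul_of_nonneg_left (hw.trans (le_abs_self c))
      (abs_nonneg _)) (abs_nonneg _)
  have hx : |(x : ℂ).im| ≤ c := by
    rw [Complex.ofReal_im, abs_zero]; exact (abs_nonneg _).trans hz
  rcases eq_or_ne z x with rfl | hne
  · rw [dslope_same]
    exact hd _ hx
  · have hconv : Convex ℝ {w : ℂ | |w.im| ≤ c} := by
      have : {w : ℂ | |w.im| ≤ c} = Complex.imCLM ⁻¹' Icc (-c) c := by
        ext w; simp [abs_le]
      rw [this]
      exact (convex_Icc _ _).linear_preimage Complex.imCLM.toLinearMap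
    have h1 := hconv.norm_image_sub_le_of_norm_deriv_le
      (fun w _ => differentiable_sin_pi_mul_div (h := h) w) hd hx hz
    have h2 : 0 < ‖z - x‖ := norm_pos_iff.mpr (sub_ne_zero.mpr hne)
    rw [dslope_of_ne _ hne, slope_def_field, norm_div, div_le_iff₀ h2]
    exact h1

/-- At a node the sine vanishes, so the divided difference is sin(πx/h)/(x - kh), a multiple of the
sinc function. This turns the residue sum into the sinc series, including the case where x is itself
a node. -/
theorem dslope_sin_lattice (hh : 0 < h) (x : ℝ) (k : ℤ) :
    (-1) ^ k * dslope (fun z : ℂ => Complex.sin (Real.pi * z / h)) x ((k * h : ℝ) : ℂ) =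
      (Real.pi / h) * (Real.sinc (Real.pi * (x / h - k)) : ℂ) := by
  have hsq : ((-1 : ℂ)) ^ k * (-1) ^ k = 1 := by
    rw [← mul_zpow]; simp
  have hh' : (h : ℂ) ≠ 0 := by exact_mod_cast hh.ne'
  have hpi : (Real.pi : ℂ) ≠ 0 := by exact_mod_cast Real.pi_ne_zero
  rcases eq_or_ne x (k * h) with rfl | hne
  · rw [dslope_same, deriv_sin_pi_mul_div, cos_lattice hh.ne', ← mul_assoc, hsq,
      mul_div_cancel_right₀ _ hh.ne', sub_self, mul_zero, Real.sinc_zero]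
    simp
  · have hne' : ((k * h : ℝ) : ℂ) ≠ x := by exact_mod_cast hne.symm
    have h3 : ((k * h : ℝ) : ℂ) - x ≠ 0 := sub_ne_zero.mpr hne'
    have h4 : x / h - k ≠ 0 := by
      intro h0
      apply hne
      field_simp at h0
      linarith
    have h5 : ((x / h - k : ℝ) : ℂ) ≠ 0 := by exact_mod_cast h4
    rw [dslope_of_ne _ hne', slope_def_field, sin_lattice hh.ne',
      Real.sinc_of_ne_zero (mul_ne_zero Real.pi_ne_zero h4),
      show Real.pi * (x / h - k) = Real.pi * x / h - k * Real.pi by ring,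
      Real.sin_sub_int_mul_pi]
    have h6 : ((k * h : ℝ) : ℂ) - x = -(h * ((x / h - k : ℝ) : ℂ)) := by
      push_cast
      field_simp
      ring
    rw [h6, show Real.pi * x / h - k * Real.pi = Real.pi * (x / h - k) by ring]
    push_cast
    push_cast at h5
    generalize Complex.sin (Real.pi * x / h) = S
    field_simp
    ring

/-- The error of the Sinc interpolation as a contour integral. -/
theorem sinc_interpolation_error (hh : 0 < h) (hc : 0 < c) {F : ℂ → ℂ}
    (hF : ∀ z : ℂ, |z.im| ≤ c → DifferentiableAt ℂ F z)
    (hFg : ∀ z : ℂ, |z.im| ≤ c → ‖F z‖ ≤ g z.re) (hg : Integrable g)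
    (hg0 : Tendsto g (cocompact ℝ) (𝓝 0)) (hgs : Summable fun k : ℤ => g (k * h)) (x : ℝ) :
    2 * Real.pi * Complex.I *
        (F x - ∑' k : ℤ, F ((k * h : ℝ) : ℂ) * (Real.sinc (Real.pi * (x / h - k)) : ℂ)) =
      (∫ t : ℝ, F (t + ((-c : ℝ) : ℂ) * Complex.I) *
        ((Complex.sin (Real.pi * (t + ((-c : ℝ) : ℂ) * Complex.I) / h))⁻¹ *
          (Complex.sin (Real.pi * x / h) * (t + ((-c : ℝ) : ℂ) * Complex.I - x)⁻¹))) -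
      ∫ t : ℝ, F (t + (c : ℂ) * Complex.I) *
        ((Complex.sin (Real.pi * (t + (c : ℂ) * Complex.I) / h))⁻¹ *
          (Complex.sin (Real.pi * x / h) * (t + (c : ℂ) * Complex.I - x)⁻¹)) := by
  -- D(z) = (sin(πz/h) - sin(πx/h))/(z - x) is entire, and F·D/sin(πz/h) is F/(z - x) minus the
  -- desired kernel. Evaluating the two pieces separately avoids a double pole when x is a node.
  set D := dslope (fun z : ℂ => Complex.sin (Real.pi * z / h)) x with hD
  set C := Real.cosh (Real.pi * c / h) * (Real.pi / h)
  have hDd : Differentiable ℂ D := by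
    rw [← differentiableOn_univ, hD, Complex.differentiableOn_dslope univ_mem]
    exact differentiable_sin_pi_mul_div.differentiableOn
  have hA := integral_div_sin_strip (A := fun z => F z * D z) (g := fun t => g t * C) hh hc
    (fun z hz => (hF z hz).mul (hDd z))
    (fun z hz => by
      rw [norm_mul]
      exact mul_le_mul (hFg z hz) (norm_dslope_sin_le hh x hz) (norm_nonneg _)
        ((norm_nonneg _).trans (hFg z hz)))
    (hg.mul_const _) (by simpa using hg0.mul_const C) (hgs.mul_right _)
  have hB := integral_div_sub_strip hc hF hFg hg hg0 x
  have hsub : ∀ s : ℝ, s = -c ∨ s = c →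
      (∫ t : ℝ, F (t + (s : ℂ) * Complex.I) * D (t + (s : ℂ) * Complex.I) /
        Complex.sin (Real.pi * (t + (s : ℂ) * Complex.I) / h)) =
      (∫ t : ℝ, F (t + (s : ℂ) * Complex.I) / (t + (s : ℂ) * Complex.I - x)) -
      ∫ t : ℝ, F (t + (s : ℂ) * Complex.I) *
        ((Complex.sin (Real.pi * (t + (s : ℂ) * Complex.I) / h))⁻¹ *
          (Complex.sin (Real.pi * x / h) * (t + (s : ℂ) * Complex.I - x)⁻¹)) := by
    intro s hs
    have hinv : Continuous fun t : ℝ => (t + (s : ℂ) * Complex.I - x)⁻¹ :=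
      Continuous.inv₀ (by fun_prop) fun t => line_sub_ne_zero hc hs t x
    rw [← integral_sub]
    · refine integral_congr_ae (ae_of_all _ fun t => ?_)
      have h1 := line_sub_ne_zero hc hs t x
      have h2 := sin_line_ne_zero hh hc hs t
      simp only [hD]
      rw [dslope_of_ne _ (sub_ne_zero.mp h1), slope_def_field]
      generalize Complex.sin (Real.pi * x / h) = S
      generalize Complex.sin (Real.pi * (t + (s : ℂ) * Complex.I) / h) = S' at h2 ⊢
      field_simp
    · exact integrable_line_mul hF hFg hg (abs_eq_of_line hc hs) hinv
        (norm_inv_line_sub_le hc hs · x)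
    · refine integrable_line_mul hF hFg hg (abs_eq_of_line hc hs)
        ((continuous_inv_sin_line hh hc hs).mul (continuous_const.mul hinv)) (fun t => ?_)
        (C := (Real.sinh (Real.pi * c / h))⁻¹ * (‖Complex.sin (Real.pi * x / h)‖ * c⁻¹))
      rw [norm_mul, norm_mul]
      have h1 := norm_inv_sin_line_le hh hc hs t
      have h2 := norm_inv_line_sub_le hc hs t x
      gcongr
  rw [hsub _ (Or.inl rfl), hsub _ (Or.inr rfl)] at hA
  have hsum : ∑' k : ℤ, (-1 : ℂ) ^ k * (F ((k * h : ℝ) : ℂ) * D ((k * h : ℝ) : ℂ)) =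
      (Real.pi / h) * ∑' k : ℤ, F ((k * h : ℝ) : ℂ) *
        (Real.sinc (Real.pi * (x / h - k)) : ℂ) := by
    rw [← tsum_mul_left]
    refine tsum_congr fun k => ?_
    linear_combination (F ((k * h : ℝ) : ℂ)) * dslope_sin_lattice hh x k
  rw [hsum] at hA
  have hh' : (h : ℂ) ≠ 0 := by exact_mod_cast hh.ne'
  have h7 : 2 * Complex.I * h * ((Real.pi / h) * ∑' k : ℤ, F ((k * h : ℝ) : ℂ) *
        (Real.sinc (Real.pi * (x / h - k)) : ℂ)) = 2 * Real.pi * Complex.I *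
        ∑' k : ℤ, F ((k * h : ℝ) : ℂ) * (Real.sinc (Real.pi * (x / h - k)) : ℂ) := by
    rw [← mul_assoc]
    congr 1
    field_simp
  rw [h7] at hA
  linear_combination hA - hB

end Strip

/-! ### The discretization error of indefinite integration -/

/-- With θ = π/2 - arctan w the left side is sin θ ≤ θ. In this form the boundary terms of the next
integration by parts add up with an arctangent integral. -/
theorem inv_sqrt_one_add_sq_le_arctan (w : ℝ) :
    1 / √(1 + w ^ 2) ≤ Real.pi / 2 - Real.arctan w := by
  rw [← Real.cos_arctan, ← Real.sin_pi_div_two_sub]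
  exact Real.sin_le (by linarith [Real.arctan_lt_pi_div_two w])

section Strip

variable {h c : ℝ} {g : ℝ → ℝ}

theorem norm_inv_line_sub (hc : 0 < c) {s : ℝ} (hs : s = -c ∨ s = c) (t x : ℝ) :
    ‖(t + (s : ℂ) * Complex.I - x)⁻¹‖ = 1 / c * (1 / √(1 + ((x - t) / c) ^ 2)) := by
  have h1 : ‖(t + (s : ℂ) * Complex.I - x)‖ = c * √(1 + ((x - t) / c) ^ 2) := by
    rw [Complex.norm_eq_sqrt_sq_add_sq, Complex.sub_re, Complex.sub_im, line_re, line_im,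
      Complex.ofReal_re, Complex.ofReal_im, sub_zero]
    have : s ^ 2 = c ^ 2 := by rcases hs with rfl | rfl <;> ring
    rw [this, show (t - x) ^ 2 + c ^ 2 = c ^ 2 * (1 + ((x - t) / c) ^ 2) by field_simp; ring,
      Real.sqrt_mul (sq_nonneg c), Real.sqrt_sq hc.le]
  rw [norm_inv, h1, mul_inv, one_div, one_div]

/-- Integrating the sine and differentiating u = 1/(z - x) gives u' = u², and ∫|u|² is a difference
of arctangents divided by c. The two boundary terms supply at most the missing parts of the total
variation π, so the sum is (h/π)(π/c), whatever a and b are. Taking absolute values before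
integrating by parts would lose this uniformity. -/
theorem norm_integral_sin_mul_inv_line_le (hh : 0 < h) (hc : 0 < c) {s : ℝ} (hs : s = -c ∨ s = c)
    (t : ℝ) {a b : ℝ} (hab : a ≤ b) :
    ‖∫ x in a..b, Complex.sin (Real.pi * x / h) * (t + (s : ℂ) * Complex.I - x)⁻¹‖ ≤ h / c := by
  have hpi := Real.pi_pos
  have hh' : (h : ℂ) ≠ 0 := by exact_mod_cast hh.ne'
  have hpi' : (Real.pi : ℂ) ≠ 0 := by exact_mod_cast hpi.ne'
  have hinv : Continuous fun x : ℝ => (t + (s : ℂ) * Complex.I - x)⁻¹ :=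
    Continuous.inv₀ (by fun_prop) fun x => line_sub_ne_zero hc hs t x
  have hu : ∀ x : ℝ, HasDerivAt (fun x : ℝ => (t + (s : ℂ) * Complex.I - x)⁻¹)
      ((t + (s : ℂ) * Complex.I - x)⁻¹ ^ 2) x := by
    intro x
    have h1 : HasDerivAt (fun x : ℂ => (t + (s : ℂ) * Complex.I - x)) (-1) (x : ℂ) :=
      (hasDerivAt_id (x : ℂ)).const_sub _
    refine (h1.inv (line_sub_ne_zero hc hs t x)).comp_ofReal.congr_deriv ?_
    rw [neg_neg, one_div, inv_pow]
  have hv : ∀ x : ℝ, HasDerivAt (fun x : ℝ => -(h / Real.pi * Complex.cos (Real.pi * x / h)))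
      (Complex.sin (Real.pi * x / h)) x := by
    intro x
    have h1 : HasDerivAt (fun z : ℂ => (Real.pi * z / h : ℂ)) (Real.pi * 1 / h) (x : ℂ) :=
      ((hasDerivAt_id (x : ℂ)).const_mul _).div_const _
    refine ((h1.ccos.const_mul (h / Real.pi : ℂ)).neg.comp_ofReal).congr_deriv ?_
    field_simp
  have hvn : ∀ x : ℝ, ‖-(h / Real.pi * Complex.cos (Real.pi * x / h))‖ ≤ h / Real.pi := by
    intro x
    have h1 : ‖(h / Real.pi : ℂ)‖ = h / Real.pi := by
      rw [← Complex.ofReal_div, Complex.norm_of_nonneg (by positivity)]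
    rw [norm_neg, norm_mul, h1]
    refine mul_le_of_le_one_right (by positivity) ?_
    refine (norm_cos_le_cosh _).trans ?_
    rw [pi_mul_div_im, Complex.ofReal_im]
    simp
  have hparts := intervalIntegral.integral_mul_deriv_eq_deriv_mul (a := a) (b := b)
    (fun x _ => hu x) (fun x _ => hv x) ((hinv.pow 2).intervalIntegrable _ _)
    ((by fun_prop : Continuous fun x : ℝ => Complex.sin (Real.pi * x / h)).intervalIntegrable _ _)
  have hcomm : ∫ x in a..b, Complex.sin (Real.pi * x / h) * (t + (s : ℂ) * Complex.I - x)⁻¹ =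
      ∫ x in a..b, (t + (s : ℂ) * Complex.I - x)⁻¹ * Complex.sin (Real.pi * x / h) := by
    simp only [mul_comm]
  set T : ℝ → ℝ := fun x => Real.arctan ((x - t) / c) with hT
  have hub : ‖(t + (s : ℂ) * Complex.I - b)⁻¹‖ ≤ 1 / c * (Real.pi / 2 - T b) := by
    rw [norm_inv_line_sub hc hs]
    exact mul_le_mul_of_nonneg_left (inv_sqrt_one_add_sq_le_arctan _) (by positivity)
  have hua : ‖(t + (s : ℂ) * Complex.I - a)⁻¹‖ ≤ 1 / c * (Real.pi / 2 + T a) := by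
    rw [norm_inv_line_sub hc hs]
    refine mul_le_mul_of_nonneg_left ?_ (by positivity)
    have := inv_sqrt_one_add_sq_le_arctan (-((a - t) / c))
    rwa [neg_sq, Real.arctan_neg, sub_neg_eq_add] at this
  have hTd : ∀ x : ℝ, HasDerivAt (fun x => 1 / c * T x)
      (‖(t + (s : ℂ) * Complex.I - x)⁻¹‖ ^ 2) x := by
    intro x
    have h1 : HasDerivAt (fun x : ℝ => (x - t) / c) (1 / c) x :=
      ((hasDerivAt_id x).sub_const t).div_const c
    refine (h1.arctan.const_mul (1 / c)).congr_deriv ?_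
    have : 0 < 1 + ((x - t) / c) ^ 2 := by positivity
    rw [norm_inv_line_sub hc hs, mul_pow, div_pow 1 (√_), Real.sq_sqrt this.le]
    ring
  have hI : ‖∫ x in a..b, (t + (s : ℂ) * Complex.I - x)⁻¹ ^ 2 *
      -(h / Real.pi * Complex.cos (Real.pi * x / h))‖ ≤
      h / Real.pi * (1 / c * T b - 1 / c * T a) := by
    have h1 : ∫ x in a..b, h / Real.pi * ‖(t + (s : ℂ) * Complex.I - x)⁻¹‖ ^ 2 =
        h / Real.pi * (1 / c * T b - 1 / c * T a) := by
      rw [intervalIntegral.integral_const_mul, intervalIntegral.integral_eq_sub_of_hasDerivAt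
        (fun x _ => hTd x) ((hinv.norm.pow 2).intervalIntegrable _ _)]
    rw [← h1]
    refine intervalIntegral.norm_integral_le_of_norm_le hab (ae_of_all _ fun x _ => ?_)
      ((continuous_const.mul (hinv.norm.pow 2)).intervalIntegrable _ _)
    rw [norm_mul, norm_pow, mul_comm]
    exact mul_le_mul_of_nonneg_right (hvn x) (by positivity)
  rw [hcomm, hparts]
  refine (norm_sub_le _ _).trans ?_
  refine (add_le_add (norm_sub_le _ _) le_rfl).trans ?_
  rw [norm_mul, norm_mul]
  have h1 := mul_le_mul hub (hvn b) (norm_nonneg _) ((norm_nonneg _).trans hub)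
  have h2 := mul_le_mul hua (hvn a) (norm_nonneg _) ((norm_nonneg _).trans hua)
  have h3 : 1 / c * (Real.pi / 2 - T b) * (h / Real.pi) + 1 / c * (Real.pi / 2 + T a) *
      (h / Real.pi) + h / Real.pi * (1 / c * T b - 1 / c * T a) = h / c := by
    field_simp
    ring
  linarith

/-- Fubini puts the oscillatory x-integral inside, where it is at most h/c for every t; the
remaining t-integral is controlled by g. -/
theorem intervalIntegral_line_kernel_le (hh : 0 < h) (hc : 0 < c) {F : ℂ → ℂ}
    (hF : ∀ z : ℂ, |z.im| ≤ c → DifferentiableAt ℂ F z)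
    (hFg : ∀ z : ℂ, |z.im| ≤ c → ‖F z‖ ≤ g z.re) (hg : Integrable g)
    {s : ℝ} (hs : s = -c ∨ s = c) {a b : ℝ} (hab : a ≤ b) :
    IntervalIntegrable (fun x : ℝ => ∫ t : ℝ, F (t + (s : ℂ) * Complex.I) *
        ((Complex.sin (Real.pi * (t + (s : ℂ) * Complex.I) / h))⁻¹ *
          (Complex.sin (Real.pi * x / h) * (t + (s : ℂ) * Complex.I - x)⁻¹))) volume a b ∧
    ‖∫ x in a..b, ∫ t : ℝ, F (t + (s : ℂ) * Complex.I) *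
        ((Complex.sin (Real.pi * (t + (s : ℂ) * Complex.I) / h))⁻¹ *
          (Complex.sin (Real.pi * x / h) * (t + (s : ℂ) * Complex.I - x)⁻¹))‖ ≤
      (∫ t, g t) * ((Real.sinh (Real.pi * c / h))⁻¹ * (h / c)) := by
  have hsc := abs_eq_of_line hc hs
  have hs0 := sinh_pos_line hh hc
  have hFn : ∀ t : ℝ, ‖F (t + (s : ℂ) * Complex.I)‖ ≤ g t := by
    intro t
    have h1 := hFg (t + (s : ℂ) * Complex.I) (by rwa [line_im])
    rwa [line_re] at h1
  have hg0 : ∀ t, 0 ≤ g t := fun t => (norm_nonneg _).trans (hFn t)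
  have hsinx : ∀ x : ℝ, ‖Complex.sin (Real.pi * x / h)‖ ≤ 1 := by
    intro x
    rw [show (Real.pi * x / h : ℂ) = ((Real.pi * x / h : ℝ) : ℂ) by push_cast; rfl,
      ← Complex.ofReal_sin, Complex.norm_real]
    exact Real.abs_sin_le_one _
  have hK : Integrable (Function.uncurry fun x t : ℝ => F (t + (s : ℂ) * Complex.I) *
        ((Complex.sin (Real.pi * (t + (s : ℂ) * Complex.I) / h))⁻¹ *
          (Complex.sin (Real.pi * x / h) * (t + (s : ℂ) * Complex.I - x)⁻¹)))
        ((volume.restrict (uIoc a b)).prod volume) := by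
    have : IsFiniteMeasure (volume.restrict (uIoc a b)) := by
      rw [uIoc_of_le hab]; infer_instance
    have hb : Integrable (fun p : ℝ × ℝ => g p.2 * ((Real.sinh (Real.pi * c / h))⁻¹ * (1 * c⁻¹)))
        ((volume.restrict (uIoc a b)).prod volume) :=
      (hg.comp_snd _).mul_const _
    refine hb.mono' (Continuous.aestronglyMeasurable ?_) (ae_of_all _ fun p => ?_)
    · rw [Function.uncurry_def]
      refine ((continuous_line hF hsc).comp continuous_snd).mul
        (((continuous_inv_sin_line hh hc hs).comp continuous_snd).mul ?_)
      exact Continuous.mul (by fun_prop)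
        (Continuous.inv₀ (by fun_prop) fun p => line_sub_ne_zero hc hs p.2 p.1)
    · rw [Function.uncurry_def]
      simp only [norm_mul]
      have h1 := norm_inv_sin_line_le hh hc hs p.2
      have h2 := norm_inv_line_sub_le hc hs p.2 p.1
      have h3 := hFn p.2
      have h4 := hsinx p.1
      have h5 := hg0 p.2
      gcongr
  refine ⟨?_, ?_⟩
  · rw [intervalIntegrable_iff]
    exact hK.integral_prod_left
  · rw [intervalIntegral_integral_swap hK, ← integral_mul_const]
    refine norm_integral_le_of_norm_le (hg.mul_const _) (ae_of_all _ fun t => ?_)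
    rw [intervalIntegral.integral_const_mul, intervalIntegral.integral_const_mul, norm_mul,
      norm_mul]
    have h1 := norm_inv_sin_line_le hh hc hs t
    have h2 := norm_integral_sin_mul_inv_line_le hh hc hs t hab
    have h3 := hFn t
    have h5 := hg0 t
    gcongr

/-- The interpolation error is integrated termwise, sinc becoming a difference of J. The two lines
contribute equally, which against the factor 2π leaves 1/π. -/
theorem norm_integral_sub_tsum_J_le (hh : 0 < h) (hc : 0 < c) {F : ℂ → ℂ}
    (hF : ∀ z : ℂ, |z.im| ≤ c → DifferentiableAt ℂ F z)
    (hFg : ∀ z : ℂ, |z.im| ≤ c → ‖F z‖ ≤ g z.re) (hg : Integrable g)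
    (hg0 : Tendsto g (cocompact ℝ) (𝓝 0)) (hgs : Summable fun k : ℤ => g (k * h))
    {a b : ℝ} (hab : a ≤ b) :
    ‖(∫ x in a..b, F x) - ∑' k : ℤ, F ((k * h : ℝ) : ℂ) * ((J k h b - J k h a : ℝ) : ℂ)‖ ≤
      (∫ t, g t) / Real.pi * ((Real.sinh (Real.pi * c / h))⁻¹ * (h / c)) := by
  have hFk : ∀ k : ℤ, ‖F ((k * h : ℝ) : ℂ)‖ ≤ g (k * h) := by
    intro k
    have := hFg ((k * h : ℝ) : ℂ) (by rw [Complex.ofReal_im, abs_zero]; exact hc.le)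
    rwa [Complex.ofReal_re] at this
  have hterm : ∀ (k : ℤ) (x : ℝ),
      ‖F ((k * h : ℝ) : ℂ) * (Real.sinc (Real.pi * (x / h - k)) : ℂ)‖ ≤ g (k * h) := by
    intro k x
    rw [norm_mul, Complex.norm_real]
    exact (mul_le_of_le_one_right (norm_nonneg _) (Real.abs_sinc_le_one _)).trans (hFk k)
  have hsc : ∀ k : ℤ, Continuous fun x : ℝ =>
      F ((k * h : ℝ) : ℂ) * (Real.sinc (Real.pi * (x / h - k)) : ℂ) := by
    intro k
    have : Continuous fun x : ℝ => Real.sinc (Real.pi * (x / h - k)) :=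
      Real.continuous_sinc.comp (by fun_prop)
    fun_prop
  have hTc : Continuous fun x : ℝ =>
      ∑' k : ℤ, F ((k * h : ℝ) : ℂ) * (Real.sinc (Real.pi * (x / h - k)) : ℂ) :=
    continuous_tsum hsc hgs hterm
  have hTsum : ∀ x : ℝ, Summable fun k : ℤ =>
      F ((k * h : ℝ) : ℂ) * (Real.sinc (Real.pi * (x / h - k)) : ℂ) := fun x =>
    Summable.of_norm_bounded hgs fun k => hterm k x
  have hint := intervalIntegral.hasSum_integral_of_dominated_convergence (a := a) (b := b)
    (μ := volume) (f := fun x : ℝ =>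
      ∑' k : ℤ, F ((k * h : ℝ) : ℂ) * (Real.sinc (Real.pi * (x / h - k)) : ℂ))
    (F := fun (k : ℤ) (x : ℝ) => F ((k * h : ℝ) : ℂ) * (Real.sinc (Real.pi * (x / h - k)) : ℂ))
    (fun k _ => g (k * h)) (fun k => (hsc k).aestronglyMeasurable)
    (fun k => ae_of_all _ fun x _ => hterm k x) (ae_of_all _ fun _ _ => hgs)
    (continuous_const.intervalIntegrable _ _) (ae_of_all _ fun x _ => (hTsum x).hasSum)
  have hterm2 : ∀ k : ℤ, (∫ x in a..b, F ((k * h : ℝ) : ℂ) *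
      (Real.sinc (Real.pi * (x / h - k)) : ℂ)) =
      F ((k * h : ℝ) : ℂ) * ((J k h b - J k h a : ℝ) : ℂ) := by
    intro k
    rw [intervalIntegral.integral_const_mul, intervalIntegral.integral_ofReal,
      integral_sinc_eq_J_sub k hh]
  simp only [hterm2] at hint
  have hFc : Continuous fun x : ℝ => F x := by
    have := continuous_line hF (s := 0) (by rw [abs_zero]; exact hc.le)
    simpa using this
  rw [hint.tsum_eq, ← intervalIntegral.integral_sub (hFc.intervalIntegrable _ _)
    (hTc.intervalIntegrable _ _)]
  have hm := intervalIntegral_line_kernel_le hh hc hF hFg hg (Or.inl rfl) hab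
  have hp := intervalIntegral_line_kernel_le hh hc hF hFg hg (Or.inr rfl) hab
  have herr := fun x : ℝ => sinc_interpolation_error hh hc hF hFg hg hg0 hgs x
  have h2pi : ‖(2 * Real.pi * Complex.I : ℂ)‖ = 2 * Real.pi := by
    rw [norm_mul, Complex.norm_I, mul_one, norm_mul, Complex.norm_of_nonneg Real.pi_pos.le]
    simp
  have hmul : ‖(2 * Real.pi * Complex.I : ℂ) * ∫ x in a..b, (F x -
      ∑' k : ℤ, F ((k * h : ℝ) : ℂ) * (Real.sinc (Real.pi * (x / h - k)) : ℂ))‖ ≤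
      (∫ t, g t) * ((Real.sinh (Real.pi * c / h))⁻¹ * (h / c)) +
      (∫ t, g t) * ((Real.sinh (Real.pi * c / h))⁻¹ * (h / c)) := by
    rw [← intervalIntegral.integral_const_mul]
    simp only [herr]
    rw [intervalIntegral.integral_sub hm.1 hp.1]
    exact (norm_sub_le _ _).trans (add_le_add hm.2 hp.2)
  rw [norm_mul, h2pi] at hmul
  have hpi := Real.pi_pos
  rw [div_mul_eq_mul_div, le_div_iff₀ hpi]
  linarith

/-- The discretization error of the Sinc indefinite integration on the real line. -/
theorem norm_integral_Iic_sub_tsum_J_le (hh : 0 < h) (hc : 0 < c) {F : ℂ → ℂ}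
    (hF : ∀ z : ℂ, |z.im| ≤ c → DifferentiableAt ℂ F z)
    (hFg : ∀ z : ℂ, |z.im| ≤ c → ‖F z‖ ≤ g z.re) (hg : Integrable g)
    (hg0 : Tendsto g (cocompact ℝ) (𝓝 0)) (hgs : Summable fun k : ℤ => g (k * h)) (ξ : ℝ) :
    ‖(∫ x in Iic ξ, F x) - ∑' k : ℤ, F ((k * h : ℝ) : ℂ) * (J k h ξ : ℂ)‖ ≤
      (∫ t, g t) / Real.pi * ((Real.sinh (Real.pi * c / h))⁻¹ * (h / c)) := by
  have hFr : ∀ x : ℝ, ‖F x‖ ≤ g x := by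
    intro x
    have := hFg x (by rw [Complex.ofReal_im, abs_zero]; exact hc.le)
    rwa [Complex.ofReal_re] at this
  have hFc : Continuous fun x : ℝ => F x := by
    have := continuous_line hF (s := 0) (by rw [abs_zero]; exact hc.le)
    simpa using this
  have hFi : Integrable fun x : ℝ => F x :=
    hg.mono' hFc.aestronglyMeasurable (ae_of_all _ hFr)
  have h1 := intervalIntegral_tendsto_integral_Iic (μ := volume) ξ hFi.integrableOn
    (tendsto_id (x := (atBot : Filter ℝ)))
  have h2 : Tendsto (fun a : ℝ => ∑' k : ℤ, F ((k * h : ℝ) : ℂ) *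
      ((J k h ξ - J k h a : ℝ) : ℂ)) atBot
      (𝓝 (∑' k : ℤ, F ((k * h : ℝ) : ℂ) * (J k h ξ : ℂ))) := by
    refine tendsto_tsum_of_dominated_convergence (hgs.mul_right (3 * h)) (fun k => ?_)
      (Eventually.of_forall fun a k => ?_)
    · have h3 : Tendsto (fun a => J k h ξ - J k h a) atBot (𝓝 (J k h ξ)) := by
        simpa using tendsto_const_nhds.sub (tendsto_J_atBot k hh)
      exact ((Complex.continuous_ofReal.tendsto _).comp h3).const_mul _
    · rw [norm_mul, Complex.norm_real]
      have h4 : ‖J k h ξ - J k h a‖ ≤ 3 * h := by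
        refine (norm_sub_le _ _).trans ?_
        have h5 := abs_J_le k hh ξ
        have h6 := abs_J_le k hh a
        rw [Real.norm_eq_abs, Real.norm_eq_abs]
        linarith
      exact mul_le_mul (hFr _) h4 (norm_nonneg _) ((norm_nonneg _).trans (hFr _))
  refine le_of_tendsto (h1.sub h2).norm ?_
  filter_upwards [eventually_le_atBot ξ] with a ha
  exact norm_integral_sub_tsum_J_le hh hc hF hFg hg hg0 hgs ha

/-- The discretization error when the integrand is analytic in the open strip only. -/
theorem norm_integral_Iic_sub_tsum_J_le_strip {d : ℝ} (hh : 0 < h) (hd : 0 < d) {F : ℂ → ℂ}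
    (hF : ∀ z ∈ strip d, DifferentiableAt ℂ F z)
    (hFg : ∀ z ∈ strip d, ‖F z‖ ≤ g z.re) (hg : Integrable g)
    (hg0 : Tendsto g (cocompact ℝ) (𝓝 0)) (hgs : Summable fun k : ℤ => g (k * h)) (ξ : ℝ) :
    ‖(∫ x in Iic ξ, F x) - ∑' k : ℤ, F ((k * h : ℝ) : ℂ) * (J k h ξ : ℂ)‖ ≤
      (∫ t, g t) / Real.pi * ((Real.sinh (Real.pi * d / h))⁻¹ * (h / d)) := by
  have hcont : ContinuousAt (fun c : ℝ => (∫ t, g t) / Real.pi *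
      ((Real.sinh (Real.pi * c / h))⁻¹ * (h / c))) d := by
    refine continuousAt_const.mul (ContinuousAt.mul (ContinuousAt.inv₀ ?_
      (sinh_pos_line hh hd).ne') (continuousAt_const.div continuousAt_id hd.ne'))
    exact (Real.continuous_sinh.comp (by fun_prop)).continuousAt
  -- The estimate holds for every c < d with the same left side, and its right side is continuous at
  -- d.
  refine ge_of_tendsto (hcont.tendsto.mono_left (nhdsWithin_le_nhds (s := Iio d))) ?_
  have : ∀ᶠ c in 𝓝[<] d, 0 < c := nhdsWithin_le_nhds (eventually_gt_nhds hd)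
  filter_upwards [this, self_mem_nhdsWithin] with c hc hcd
  exact norm_integral_Iic_sub_tsum_J_le hh hc (fun z hz => hF z (lt_of_le_of_lt hz hcd))
    (fun z hz => hFg z (lt_of_le_of_lt hz hcd)) hg hg0 hgs ξ

end Strip

/-! ### Decay of the transformed integrand -/

theorem one_add_sq_div_two_le_cosh (x : ℝ) : 1 + x ^ 2 / 2 ≤ Real.cosh x := by
  have h1 : Real.cosh x = 1 + 2 * Real.sinh (x / 2) ^ 2 := by
    have h2 := Real.cosh_two_mul (x / 2)
    rw [mul_div_cancel₀ x two_ne_zero, Real.cosh_sq] at h2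
    linarith
  have h3 : |x / 2| ≤ |Real.sinh (x / 2)| := by
    rw [Real.abs_sinh]
    exact Real.self_le_sinh_iff.mpr (abs_nonneg _)
  have h4 := sq_le_sq.mpr h3
  rw [h1]
  linarith

/-- Writing v cosh x = v + v(cosh x - 1), the left side exceeds sin v by at most v cos v (cosh x -
1). The bounds cos v ≤ π/2 - v and Jordan's v ≤ (π/2) sin v make this a multiple of sin v, which the
quadratic term of cosh(w sinh x) dominates because w² = (π/2 - v)(π/2 + v). -/
theorem abs_sin_mul_cosh_le {v w x : ℝ} (hv0 : 0 ≤ v) (hv : v ≤ Real.pi / 2)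
    (hw : w ^ 2 = (Real.pi / 2) ^ 2 - v ^ 2) :
    |Real.sin (v * Real.cosh x)| ≤ Real.sin v * Real.cosh (w * Real.sinh x) := by
  have hpi := Real.pi_pos
  have hC := Real.one_le_cosh x
  have hS := Real.cosh_sq x
  set C := Real.cosh x
  set S := Real.sinh x
  have hsin0 : 0 ≤ Real.sin v := Real.sin_nonneg_of_nonneg_of_le_pi hv0 (by linarith)
  have hcos0 : 0 ≤ Real.cos v := Real.cos_nonneg_of_neg_pi_div_two_le_of_le (by linarith) hv
  have hcos : Real.cos v ≤ Real.pi / 2 - v := by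
    rw [← Real.sin_pi_div_two_sub]
    exact Real.sin_le (by linarith)
  have hjordan : v ≤ Real.pi / 2 * Real.sin v := by
    have h1 := mul_le_mul_of_nonneg_left (Real.mul_le_sin hv0 hv) (by positivity : 0 ≤ Real.pi / 2)
    have h2 : Real.pi / 2 * (2 / Real.pi * v) = v := by field_simp
    rwa [h2] at h1
  have hvcos : Real.cos v * v ≤ (Real.pi / 2 - v) * (Real.pi / 2 * Real.sin v) :=
    mul_le_mul hcos hjordan hv0 (by linarith)
  have hΔ : 0 ≤ v * (C - 1) := mul_nonneg hv0 (by linarith)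
  have h1 : |Real.sin (v * C)| ≤ Real.sin v + Real.cos v * (v * (C - 1)) := by
    rw [show v * C = v + v * (C - 1) by ring, Real.sin_add]
    refine (abs_add_le _ _).trans ?_
    rw [abs_mul, abs_mul, abs_of_nonneg hsin0, abs_of_nonneg hcos0]
    refine add_le_add (mul_le_of_le_one_right hsin0 (Real.abs_cos_le_one _))
      (mul_le_mul_of_nonneg_left ?_ hcos0)
    have := Real.abs_sin_le_abs (x := v * (C - 1))
    rwa [abs_of_nonneg hΔ] at this
  have h2 := one_add_sq_div_two_le_cosh (w * S)
  have h3 : 1 + (Real.pi / 2 - v) * (Real.pi / 2) * (C - 1) ≤ 1 + (w * S) ^ 2 / 2 := by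
    have h4 : (w * S) ^ 2 / 2 =
        (Real.pi / 2 - v) * (C - 1) * ((Real.pi / 2 + v) * (C + 1) / 2) := by
      rw [mul_pow, hw, show S ^ 2 = C ^ 2 - 1 by linarith]; ring
    rw [h4]
    have h5 : Real.pi / 2 ≤ (Real.pi / 2 + v) * (C + 1) / 2 := by nlinarith
    have h6 := mul_le_mul_of_nonneg_left h5
      (mul_nonneg (by linarith : 0 ≤ Real.pi / 2 - v) (by linarith : 0 ≤ C - 1))
    linarith
  calc |Real.sin (v * C)| ≤ Real.sin v + Real.cos v * v * (C - 1) := by linarith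
    _ ≤ Real.sin v + (Real.pi / 2 - v) * (Real.pi / 2 * Real.sin v) * (C - 1) := by
      have := mul_le_mul_of_nonneg_right hvcos (by linarith : 0 ≤ C - 1)
      linarith
    _ = Real.sin v * (1 + (Real.pi / 2 - v) * (Real.pi / 2) * (C - 1)) := by ring
    _ ≤ Real.sin v * Real.cosh (w * S) := mul_le_mul_of_nonneg_left (h3.trans h2) hsin0

theorem pi_div_two_mul_sinh (ζ : ℂ) :
    ((Real.pi / 2 : ℂ) * Complex.sinh ζ).re = Real.pi / 2 * (Real.sinh ζ.re * Real.cos ζ.im) ∧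
    ((Real.pi / 2 : ℂ) * Complex.sinh ζ).im = Real.pi / 2 * (Real.cosh ζ.re * Real.sin ζ.im) := by
  have h1 : (Real.pi / 2 : ℂ) = ((Real.pi / 2 : ℝ) : ℂ) := by push_cast; rfl
  have h2 : Complex.sinh ζ = ((Real.sinh ζ.re * Real.cos ζ.im : ℝ) : ℂ) +
      ((Real.cosh ζ.re * Real.sin ζ.im : ℝ) : ℂ) * Complex.I := by
    conv_lhs => rw [← Complex.re_add_im ζ, Complex.sinh_add, Complex.cosh_mul_I, Complex.sinh_mul_I]
    push_cast
    ring
  rw [h1, Complex.re_ofReal_mul, Complex.im_ofReal_mul, h2, line_re, line_im]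
  exact ⟨rfl, rfl⟩

/-- With u the real part of (π/2) sinh ζ and v = (π/2) sin|Im ζ|, the squared modulus is cosh² u -
sin²(v cosh(Re ζ)), and the squared left side is cosh² u - cosh² u sin² v. The claim is thus
`abs_sin_mul_cosh_le` squared; the rest handles the sign of Im ζ. -/
theorem cosh_mul_cos_le_norm_cosh {ζ : ℂ} (hζ : |ζ.im| ≤ Real.pi / 2) :
    Real.cosh (Real.pi / 2 * (Real.sinh ζ.re * Real.cos ζ.im)) *
      Real.cos (Real.pi / 2 * Real.sin ζ.im) ≤
      ‖Complex.cosh ((Real.pi / 2 : ℂ) * Complex.sinh ζ)‖ := by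
  have hpi := Real.pi_pos
  refine le_of_sq_le_sq ?_ (norm_nonneg _)
  rw [norm_cosh_sq, (pi_div_two_mul_sinh ζ).1, (pi_div_two_mul_sinh ζ).2]
  set u := Real.pi / 2 * (Real.sinh ζ.re * Real.cos ζ.im) with hu
  have hs0 : 0 ≤ Real.sin |ζ.im| :=
    Real.sin_nonneg_of_nonneg_of_le_pi (abs_nonneg _) (by linarith)
  have habs : |Real.sin ζ.im| = Real.sin |ζ.im| := by
    rcases abs_cases ζ.im with ⟨h, h'⟩ | ⟨h, h'⟩
    · rw [← h, abs_abs, abs_of_nonneg hs0]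
    · rw [h, Real.sin_neg] at hs0 ⊢
      exact abs_of_nonpos (by linarith)
  have hv1 : Real.pi / 2 * Real.sin |ζ.im| ≤ Real.pi / 2 :=
    mul_le_of_le_one_right (by positivity) (Real.sin_le_one _)
  have key := abs_sin_mul_cosh_le (v := Real.pi / 2 * Real.sin |ζ.im|)
    (w := Real.pi / 2 * Real.cos ζ.im) (x := ζ.re) (by positivity) hv1 (by
      rw [← habs, mul_pow, mul_pow, sq_abs, Real.sin_sq]; ring)
  rw [show Real.pi / 2 * Real.cos ζ.im * Real.sinh ζ.re = u by rw [hu]; ring] at key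
  have e1 : Real.sin (Real.pi / 2 * (Real.cosh ζ.re * Real.sin ζ.im)) ^ 2 =
      Real.sin (Real.pi / 2 * Real.sin |ζ.im| * Real.cosh ζ.re) ^ 2 := by
    rw [← habs]
    rcases abs_choice (Real.sin ζ.im) with h | h <;> rw [h]
    · ring_nf
    · rw [show Real.pi / 2 * -Real.sin ζ.im * Real.cosh ζ.re =
        -(Real.pi / 2 * (Real.cosh ζ.re * Real.sin ζ.im)) by ring, Real.sin_neg, neg_sq]
  have e2 : Real.sin (Real.pi / 2 * Real.sin ζ.im) ^ 2 =
      Real.sin (Real.pi / 2 * Real.sin |ζ.im|) ^ 2 := by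
    rw [← habs]
    rcases abs_choice (Real.sin ζ.im) with h | h <;> rw [h]
    rw [mul_neg, Real.sin_neg, neg_sq]
  have h1 := pow_le_pow_left₀ (abs_nonneg _) key 2
  rw [sq_abs, ← e1, mul_pow, ← e2] at h1
  rw [mul_pow, Real.cos_sq', Real.cos_sq']
  have h2 := Real.cosh_sq u
  nlinarith

theorem norm_cosh_le_cosh (z : ℂ) : ‖Complex.cosh z‖ ≤ Real.cosh z.re := by
  refine le_of_sq_le_sq ?_ (Real.cosh_pos _).le
  rw [norm_cosh_sq, Real.cosh_sq]
  linarith [Real.cos_sq_le_one z.im]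

theorem hasDerivAt_psi (ζ : ℂ) : HasDerivAt psi
    (Complex.cosh ((Real.pi / 2 : ℂ) * Complex.sinh ζ) * ((Real.pi / 2 : ℂ) * Complex.cosh ζ)) ζ :=
  ((Complex.hasDerivAt_sinh ζ).const_mul (Real.pi / 2 : ℂ)).csinh

theorem exp_abs_le_two_mul_cosh (u : ℝ) : Real.exp |u| / 2 ≤ Real.cosh u := by
  rw [← Real.cosh_abs, Real.cosh_eq]
  linarith [Real.exp_pos (-|u|)]

theorem cos_half_pi_mul_sin_pos {y : ℝ} (hy : |y| < Real.pi / 2) :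
    0 < Real.cos (Real.pi / 2 * Real.sin y) := by
  have hpi := Real.pi_pos
  have h1 := abs_lt.mp hy
  have h2 : Real.sin y < 1 := by
    rw [← Real.sin_pi_div_two]
    exact Real.sin_lt_sin_of_lt_of_le_pi_div_two (by linarith) le_rfl h1.2
  have h3 : -1 < Real.sin y := by
    rw [← Real.sin_pi_div_two, ← Real.sin_neg]
    exact Real.sin_lt_sin_of_lt_of_le_pi_div_two le_rfl (by linarith) h1.1
  exact Real.cos_pos_of_mem_Ioo ⟨by nlinarith, by nlinarith⟩

/-- The decay of the transformed integrand. -/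
theorem norm_comp_psi_mul_deriv_le {f : ℂ → ℂ} {K γ : ℝ} (hK : 0 ≤ K) (hγ : 0 ≤ γ) {ζ : ℂ}
    (hζ : |ζ.im| < Real.pi / 2) (hf : ‖f (psi ζ)‖ ≤ K * ‖E1 (psi ζ) γ‖) :
    ‖f (psi ζ) * deriv psi ζ‖ ≤ K * (Real.pi / 2) * Real.cosh ζ.re *
      (2 ^ γ * Real.exp (-(γ * (Real.pi / 2 * Real.cos ζ.im) * |Real.sinh ζ.re|)) /
        Real.cos (Real.pi / 2 * Real.sin ζ.im) ^ γ) := by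
  have hpi := Real.pi_pos
  have hq := cos_half_pi_mul_sin_pos hζ
  have hcos : 0 < Real.cos ζ.im := Real.cos_pos_of_mem_Ioo (abs_lt.mp hζ)
  set m := ‖Complex.cosh ((Real.pi / 2 : ℂ) * Complex.sinh ζ)‖ with hm
  set q := Real.cos (Real.pi / 2 * Real.sin ζ.im)
  set u := Real.pi / 2 * (Real.sinh ζ.re * Real.cos ζ.im) with hu
  have hlow : Real.exp |u| / 2 * q ≤ m :=
    (mul_le_mul_of_nonneg_right (exp_abs_le_two_mul_cosh u) hq.le).trans
      (cosh_mul_cos_le_norm_cosh hζ.le)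
  have hlow0 : 0 < Real.exp |u| / 2 * q := by positivity
  have hm0 : 0 < m := hlow0.trans_le hlow
  have habsu : |u| = Real.pi / 2 * Real.cos ζ.im * |Real.sinh ζ.re| := by
    rw [hu, abs_mul, abs_mul, abs_of_pos hcos, abs_of_pos (by positivity : 0 < Real.pi / 2)]
    ring
  -- Since 1 + ψ² = cosh², E₁ contributes m^(-γ-1). The factor m in ψ' cancels one power, leaving
  -- m^(-γ).
  have hE : ‖E1 (psi ζ) γ‖ = (m ^ γ * m)⁻¹ := by
    have h1 : 1 + psi ζ ^ 2 = Complex.cosh ((Real.pi / 2 : ℂ) * Complex.sinh ζ) ^ 2 := by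
      rw [psi, Complex.cosh_sq]; ring
    rw [E1, norm_div, norm_one, one_div, Complex.norm_cpow_real, h1, norm_pow, ← hm,
      ← Real.rpow_natCast, ← Real.rpow_mul hm0.le]
    rw [show ((2 : ℕ) : ℝ) * ((γ + 1) / 2) = γ + 1 by push_cast; ring, Real.rpow_add hm0,
      Real.rpow_one]
  have hder : ‖deriv psi ζ‖ ≤ m * (Real.pi / 2 * Real.cosh ζ.re) := by
    have h1 : ‖(Real.pi / 2 : ℂ)‖ = Real.pi / 2 := by
      rw [show (Real.pi / 2 : ℂ) = ((Real.pi / 2 : ℝ) : ℂ) by push_cast; rfl,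
        Complex.norm_of_nonneg (by positivity)]
    rw [(hasDerivAt_psi ζ).deriv, norm_mul, norm_mul, h1]
    have := norm_cosh_le_cosh ζ
    gcongr
  have hpow : (m ^ γ)⁻¹ ≤ 2 ^ γ * Real.exp (-(γ * (Real.pi / 2 * Real.cos ζ.im) *
      |Real.sinh ζ.re|)) / q ^ γ := by
    have h1 : (Real.exp |u| / 2 * q) ^ γ ≤ m ^ γ := Real.rpow_le_rpow hlow0.le hlow hγ
    refine (inv_anti₀ (by positivity) h1).trans (le_of_eq ?_)
    rw [Real.mul_rpow (by positivity) hq.le, Real.div_rpow (Real.exp_pos _).le zero_le_two,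
      ← Real.exp_mul, habsu, Real.exp_neg,
      show Real.pi / 2 * Real.cos ζ.im * |Real.sinh ζ.re| * γ =
        γ * (Real.pi / 2 * Real.cos ζ.im) * |Real.sinh ζ.re| by ring]
    have h2 : 0 < q ^ γ := Real.rpow_pos_of_pos hq _
    have h3 : (0 : ℝ) < 2 ^ γ := by positivity
    field_simp
  rw [norm_mul]
  calc ‖f (psi ζ)‖ * ‖deriv psi ζ‖
      ≤ K * (m ^ γ * m)⁻¹ * (m * (Real.pi / 2 * Real.cosh ζ.re)) := by
        rw [← hE]
        exact mul_le_mul hf hder (norm_nonneg _) (by positivity)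
    _ = K * (Real.pi / 2) * Real.cosh ζ.re * (m ^ γ)⁻¹ := by
        have : 0 < m ^ γ := Real.rpow_pos_of_pos hm0 _
        field_simp
    _ ≤ _ := mul_le_mul_of_nonneg_left hpow (by have := Real.cosh_pos ζ.re; positivity)

/-- A bound for the transformed integrand on the whole strip. -/
theorem norm_comp_psi_mul_deriv_le_strip {f : ℂ → ℂ} {K γ d μ ν : ℝ} (hK : 0 ≤ K) (hμ : 0 < μ)
    (hμγ : μ ≤ γ) (hγν : γ ≤ ν) (hd : d < Real.pi / 2) {ζ : ℂ} (hζ : ζ ∈ strip d)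
    (hf : ‖f (psi ζ)‖ ≤ K * ‖E1 (psi ζ) γ‖) :
    ‖f (psi ζ) * deriv psi ζ‖ ≤ K * (Real.pi / 2) * 2 ^ ν /
      Real.cos (Real.pi / 2 * Real.sin d) ^ ν *
        (Real.cosh ζ.re * Real.exp (-(μ * (Real.pi / 2 * Real.cos d) * |Real.sinh ζ.re|))) := by
  have hpi := Real.pi_pos
  have hζd : |ζ.im| < d := hζ
  have hd0 : 0 < d := (abs_nonneg _).trans_lt hζd
  have hζ2 := hζd.trans hd
  have hq := cos_half_pi_mul_sin_pos hζ2
  have hqd := cos_half_pi_mul_sin_pos (y := d) (by rwa [abs_of_pos hd0])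
  have hcosd : 0 < Real.cos d := Real.cos_pos_of_mem_Ioo ⟨by linarith, hd⟩
  have hcos : Real.cos d ≤ Real.cos ζ.im := by
    rw [← Real.cos_abs ζ.im]
    exact Real.cos_le_cos_of_nonneg_of_le_pi (abs_nonneg _) (by linarith) hζd.le
  have hsin : |Real.sin ζ.im| ≤ Real.sin d := by
    have h1 := abs_lt.mp hζd
    rw [abs_le]
    constructor
    · rw [← Real.sin_neg]
      exact Real.sin_le_sin_of_le_of_le_pi_div_two (by linarith) (by linarith) h1.1.le
    · exact Real.sin_le_sin_of_le_of_le_pi_div_two (by linarith) hd.le h1.2.le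
  have hqq : Real.cos (Real.pi / 2 * Real.sin d) ≤ Real.cos (Real.pi / 2 * Real.sin ζ.im) := by
    rw [← Real.cos_abs (Real.pi / 2 * Real.sin ζ.im), abs_mul,
      abs_of_pos (by positivity : 0 < Real.pi / 2)]
    refine Real.cos_le_cos_of_nonneg_of_le_pi (by positivity) ?_
      (mul_le_mul_of_nonneg_left hsin (by positivity))
    have := Real.sin_le_one d
    nlinarith
  -- Uniformity over the strip: γ is raised to ν in the powers of 2 and of the cosine (which is at
  -- most 1), lowered to μ in the exponential, and Im ζ is replaced by d.
  refine (norm_comp_psi_mul_deriv_le hK (hμ.le.trans hμγ) hζ2 hf).trans ?_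
  have h1 : (2 : ℝ) ^ γ ≤ 2 ^ ν := Real.rpow_le_rpow_of_exponent_le one_le_two hγν
  have h2 : Real.exp (-(γ * (Real.pi / 2 * Real.cos ζ.im) * |Real.sinh ζ.re|)) ≤
      Real.exp (-(μ * (Real.pi / 2 * Real.cos d) * |Real.sinh ζ.re|)) := by
    rw [Real.exp_le_exp]
    have := hμ.le.trans hμγ
    gcongr
  have h3 : Real.cos (Real.pi / 2 * Real.sin d) ^ ν ≤
      Real.cos (Real.pi / 2 * Real.sin ζ.im) ^ γ := by
    calc Real.cos (Real.pi / 2 * Real.sin d) ^ ν ≤ Real.cos (Real.pi / 2 * Real.sin d) ^ γ :=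
          Real.rpow_le_rpow_of_exponent_ge hqd (Real.cos_le_one _) hγν
      _ ≤ _ := Real.rpow_le_rpow hqd.le hqq (hμ.le.trans hμγ)
  have hqν : 0 < Real.cos (Real.pi / 2 * Real.sin d) ^ ν := Real.rpow_pos_of_pos hqd _
  have hc := Real.cosh_pos ζ.re
  calc _ ≤ K * (Real.pi / 2) * Real.cosh ζ.re *
      (2 ^ ν * Real.exp (-(μ * (Real.pi / 2 * Real.cos d) * |Real.sinh ζ.re|)) /
        Real.cos (Real.pi / 2 * Real.sin d) ^ ν) := by gcongr
    _ = _ := by ring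

/-! ### The double exponential majorant -/

/-- The double exponential majorant. -/
noncomputable def deMajorant (a x : ℝ) : ℝ := Real.cosh x * Real.exp (-(a * |Real.sinh x|))

theorem deMajorant_nonneg (a x : ℝ) : 0 ≤ deMajorant a x :=
  mul_nonneg (Real.cosh_pos x).le (Real.exp_pos _).le

theorem deMajorant_abs (a x : ℝ) : deMajorant a |x| = deMajorant a x := by
  rw [deMajorant, deMajorant, Real.cosh_abs, ← Real.abs_sinh, abs_abs]

/-- The factor cosh x is the derivative of sinh x, so the majorant has an elementary primitive on
the half-line; its integral and its tails become explicit. -/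
theorem hasDerivAt_neg_exp_sinh {a : ℝ} (ha : a ≠ 0) (x : ℝ) :
    HasDerivAt (fun x => -(1 / a * Real.exp (-(a * Real.sinh x))))
      (Real.cosh x * Real.exp (-(a * Real.sinh x))) x := by
  refine ((((Real.hasDerivAt_sinh x).const_mul a).neg).exp.const_mul (1 / a)).neg.congr_deriv ?_
  field_simp
  rfl

theorem deMajorant_of_nonneg (a : ℝ) {x : ℝ} (hx : 0 ≤ x) :
    deMajorant a x = Real.cosh x * Real.exp (-(a * Real.sinh x)) := by
  rw [deMajorant, abs_of_nonneg (Real.sinh_nonneg_iff.mpr hx)]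

/-- Half of the decay absorbs cosh x ≤ 1 + |sinh x|, and |x| ≤ |sinh x| weakens the other half to a
single exponential, enough for limits and summability. -/
theorem deMajorant_le {a : ℝ} (ha : 0 < a) (x : ℝ) :
    deMajorant a x ≤ (1 + 2 / a) * Real.exp (-(a / 2 * |x|)) := by
  set s := |Real.sinh x| with hs
  have hs0 : 0 ≤ s := abs_nonneg _
  have hxs : |x| ≤ s := by
    rw [hs, Real.abs_sinh]
    exact Real.self_le_sinh_iff.mpr (abs_nonneg _)
  have h1 : Real.cosh x ≤ 1 + s := by
    refine le_of_sq_le_sq ?_ (by positivity)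
    rw [Real.cosh_sq, ← sq_abs (Real.sinh x), ← hs]
    nlinarith
  have h2 : 1 + s ≤ (1 + 2 / a) * Real.exp (a / 2 * s) := by
    have h3 := Real.add_one_le_exp (a / 2 * s)
    have h4 : (1 + 2 / a) * (a / 2 * s + 1) = 1 + s + (2 / a + a / 2 * s) := by
      field_simp; ring
    have h5 := mul_le_mul_of_nonneg_left h3 (by positivity : 0 ≤ 1 + 2 / a)
    have h6 : 0 ≤ 2 / a + a / 2 * s := by positivity
    linarith
  calc deMajorant a x ≤ (1 + 2 / a) * Real.exp (a / 2 * s) * Real.exp (-(a * s)) :=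
        mul_le_mul_of_nonneg_right (h1.trans h2) (Real.exp_pos _).le
    _ = (1 + 2 / a) * Real.exp (-(a / 2 * s)) := by
        rw [mul_assoc, ← Real.exp_add]; ring_nf
    _ ≤ _ := by gcongr

theorem tendsto_neg_exp_sinh {a : ℝ} (ha : 0 < a) :
    Tendsto (fun x => -(1 / a * Real.exp (-(a * Real.sinh x)))) atTop (𝓝 0) := by
  have h1 : Tendsto Real.sinh atTop atTop := by
    refine tendsto_atTop_mono' _ ?_ tendsto_id
    filter_upwards [eventually_ge_atTop 0] with x hx
    exact Real.self_le_sinh_iff.mpr hx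
  have h2 := (Real.tendsto_exp_neg_atTop_nhds_zero.comp (h1.const_mul_atTop ha)).const_mul (1 / a)
  simpa using h2.neg

theorem integral_Ioi_deMajorant {a : ℝ} (ha : 0 < a) :
    IntegrableOn (deMajorant a) (Ioi 0) ∧ ∫ x in Ioi 0, deMajorant a x = 1 / a := by
  have hd : ∀ x ∈ Ici (0 : ℝ), HasDerivAt (fun x => -(1 / a * Real.exp (-(a * Real.sinh x))))
      (deMajorant a x) x := by
    intro x hx
    rw [deMajorant_of_nonneg a hx]
    exact hasDerivAt_neg_exp_sinh ha.ne' x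
  have h1 := integrableOn_Ioi_deriv_of_nonneg' hd (fun x _ => deMajorant_nonneg a x)
    (tendsto_neg_exp_sinh ha)
  refine ⟨h1, ?_⟩
  rw [integral_Ioi_of_hasDerivAt_of_tendsto' hd h1 (tendsto_neg_exp_sinh ha)]
  simp

theorem integral_deMajorant {a : ℝ} (ha : 0 < a) : ∫ x, deMajorant a x = 2 / a := by
  have := integral_comp_abs (f := deMajorant a)
  simp only [deMajorant_abs] at this
  rw [this, (integral_Ioi_deMajorant ha).2]
  ring

theorem integrable_deMajorant {a : ℝ} (ha : 0 < a) : Integrable (deMajorant a) := by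
  -- A non-integrable function has integral 0 by convention, contradicting the value 2/a.
  by_contra hne
  have h1 := integral_deMajorant ha
  rw [integral_undef hne] at h1
  have : 0 < 2 / a := by positivity
  linarith

theorem tendsto_deMajorant {a : ℝ} (ha : 0 < a) :
    Tendsto (deMajorant a) (cocompact ℝ) (𝓝 0) := by
  refine squeeze_zero (deMajorant_nonneg a) (deMajorant_le ha) ?_
  have h1 : Tendsto (fun x : ℝ => |x|) (cocompact ℝ) atTop := tendsto_norm_cocompact_atTop
  have h2 := (Real.tendsto_exp_neg_atTop_nhds_zero.comp
    (h1.const_mul_atTop (by positivity : 0 < a / 2))).const_mul (1 + 2 / a)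
  simpa using h2

theorem summable_deMajorant {a h : ℝ} (ha : 0 < a) (hh : 0 < h) :
    Summable fun k : ℤ => deMajorant a (k * h) := by
  have key : Summable fun k : ℕ => deMajorant a (k * h) := by
    have hr : Real.exp (-(a / 2 * h)) < 1 := by
      rw [Real.exp_lt_one_iff]
      have : 0 < a / 2 * h := by positivity
      linarith
    refine Summable.of_nonneg_of_le (fun k => deMajorant_nonneg _ _) (fun k => ?_)
      ((summable_geometric_of_lt_one (Real.exp_pos _).le hr).mul_left (1 + 2 / a))
    refine (deMajorant_le ha _).trans (le_of_eq ?_)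
    rw [abs_of_nonneg (by positivity), ← Real.exp_nat_mul]
    ring_nf
  refine Summable.of_nat_of_neg (by simpa using key) ?_
  refine key.congr fun k => ?_
  rw [← deMajorant_abs, ← deMajorant_abs a ((-(k : ℤ) : ℤ) * h)]
  push_cast
  rw [neg_mul, abs_neg]

/-! ### Tails of the truncated series -/

/-- The window [-M, N] grows by one index at each end, and the bounds on finite tail sums pass to
the limit. The condition -M ≤ N + 1 keeps the two new indices distinct and outside the window. -/
theorem norm_tsum_sub_sum_Icc_le {a : ℤ → ℂ} (ha : Summable a) {M N : ℤ} (hMN : -M ≤ N + 1)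
    {T₁ T₂ : ℝ} (h₁ : ∀ n : ℕ, ∑ j ∈ Finset.range n, ‖a (N + 1 + j)‖ ≤ T₁)
    (h₂ : ∀ n : ℕ, ∑ j ∈ Finset.range n, ‖a (-(M + 1 + j))‖ ≤ T₂) :
    ‖∑' k, a k - ∑ k ∈ Finset.Icc (-M) N, a k‖ ≤ T₁ + T₂ := by
  have hexp : ∀ n : ℕ, ∑ k ∈ Finset.Icc (-M - n) (N + n), a k = ∑ k ∈ Finset.Icc (-M) N, a k +
      (∑ j ∈ Finset.range n, a (N + 1 + j) + ∑ j ∈ Finset.range n, a (-(M + 1 + j))) := by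
    intro n
    induction n with
    | zero => simp
    | succ n ih =>
      have hset : Finset.Icc (-M - ((n + 1 : ℕ) : ℤ)) (N + ((n + 1 : ℕ) : ℤ)) =
          insert (N + 1 + (n : ℤ)) (insert (-(M + 1 + (n : ℤ))) (Finset.Icc (-M - n) (N + n))) := by
        ext x
        simp only [Finset.mem_Icc, Finset.mem_insert]
        push_cast
        omega
      rw [hset, Finset.sum_insert, Finset.sum_insert, ih, Finset.sum_range_succ,
        Finset.sum_range_succ]
      · ring
      · simp only [Finset.mem_Icc]; omega
      · simp only [Finset.mem_Icc, Finset.mem_insert]; omega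
  have hfin : Tendsto (fun n : ℕ => Finset.Icc (-M - n) (N + n)) atTop atTop := by
    refine Monotone.tendsto_atTop_finset (fun m n hmn => ?_)
      fun k => ⟨k.natAbs + M.natAbs + N.natAbs, ?_⟩
    · exact Finset.Icc_subset_Icc (by omega) (by omega)
    · rw [Finset.mem_Icc]; omega
  have hlim := ((ha.hasSum.comp hfin).sub_const (∑ k ∈ Finset.Icc (-M) N, a k)).norm
  refine le_of_tendsto' hlim fun n => ?_
  simp only [Function.comp_apply]
  rw [hexp, add_sub_cancel_left]
  refine (norm_add_le _ _).trans (add_le_add ?_ ?_)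
  · exact (norm_sum_le _ _).trans (h₁ n)
  · exact (norm_sum_le _ _).trans (h₂ n)

/-- Beyond the threshold the majorant is decreasing up to a factor of two. -/
theorem deMajorant_le_two_mul {a x t : ℝ} (hx : 0 ≤ x) (hxt : x ≤ t)
    (hc : 1 ≤ 2 * a * Real.cosh x) : deMajorant a t ≤ 2 * deMajorant a x := by
  rw [deMajorant_of_nonneg a hx, deMajorant_of_nonneg a (hx.trans hxt)]
  have hs : Real.sinh x ≤ Real.sinh t := Real.sinh_le_sinh.mpr hxt
  have hs0 : 0 ≤ Real.sinh x := Real.sinh_nonneg_iff.mpr hx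
  set D := Real.sinh t - Real.sinh x with hD
  have hD0 : 0 ≤ D := sub_nonneg.mpr hs
  have hcx := Real.one_le_cosh x
  have hcs : Real.sinh x ≤ Real.cosh x := (Real.sinh_lt_cosh x).le
  have h1 : Real.cosh t ≤ Real.cosh x + D := by
    refine le_of_sq_le_sq ?_ (by positivity)
    rw [Real.cosh_sq, show Real.sinh t = Real.sinh x + D by rw [hD]; ring]
    nlinarith [Real.cosh_sq x]
  -- The hypothesis gives D ≤ 2aD cosh x, so cosh x + D ≤ 2 cosh x (1 + aD).
  have h2 : Real.cosh t ≤ 2 * Real.cosh x * Real.exp (a * D) := by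
    have h3 := Real.add_one_le_exp (a * D)
    have h4 := mul_le_mul_of_nonneg_left h3 (by positivity : 0 ≤ 2 * Real.cosh x)
    nlinarith
  calc Real.cosh t * Real.exp (-(a * Real.sinh t))
      ≤ 2 * Real.cosh x * Real.exp (a * D) * Real.exp (-(a * Real.sinh t)) :=
        mul_le_mul_of_nonneg_right h2 (Real.exp_pos _).le
    _ = 2 * (Real.cosh x * Real.exp (-(a * Real.sinh x))) := by
        rw [mul_assoc, ← Real.exp_add, hD]; ring_nf

/-- The mean value theorem for the primitive gives a point t between x and x + h, and the majorant
at x + h is at most twice its value at t. Sums over the nodes then telescope. -/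
theorem mul_deMajorant_add_le {a x h : ℝ} (ha : 0 < a) (hx : 0 ≤ x) (hh : 0 < h)
    (hc : 1 ≤ 2 * a * Real.cosh x) :
    h * deMajorant a (x + h) ≤
      2 / a * (Real.exp (-(a * Real.sinh x)) - Real.exp (-(a * Real.sinh (x + h)))) := by
  obtain ⟨t, ht, hte⟩ := exists_hasDerivAt_eq_slope
    (fun x => -(1 / a * Real.exp (-(a * Real.sinh x)))) _ (by linarith : x < x + h)
    (by have := Real.continuous_sinh; fun_prop) fun y _ => hasDerivAt_neg_exp_sinh ha.ne' y
  have ht0 : 0 ≤ t := hx.trans ht.1.le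
  rw [← deMajorant_of_nonneg a ht0, add_sub_cancel_left, eq_div_iff hh.ne'] at hte
  have hct : 1 ≤ 2 * a * Real.cosh t := by
    refine hc.trans (mul_le_mul_of_nonneg_left ?_ (by positivity))
    rw [Real.cosh_le_cosh, abs_of_nonneg hx, abs_of_nonneg ht0]
    exact ht.1.le
  have h1 := deMajorant_le_two_mul ht0 ht.2.le hct
  have h2 := mul_le_mul_of_nonneg_left h1 hh.le
  have h3 : 2 / a * (Real.exp (-(a * Real.sinh x)) - Real.exp (-(a * Real.sinh (x + h)))) =
      2 * (-(1 / a * Real.exp (-(a * Real.sinh (x + h)))) -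
        -(1 / a * Real.exp (-(a * Real.sinh x)))) := by ring
  rw [h3, ← hte]
  linarith

theorem sum_deMajorant_le {a h : ℝ} {N : ℤ} (ha : 0 < a) (hh : 0 < h) (hN : 0 ≤ N)
    (hc : 1 ≤ 2 * a * Real.cosh (N * h)) (n : ℕ) :
    ∑ j ∈ Finset.range n, h * deMajorant a (((N + 1 + j : ℤ) : ℝ) * h) ≤
      2 / a * Real.exp (-(a * Real.sinh (N * h))) := by
  have hN' : (0 : ℝ) ≤ N := by exact_mod_cast hN
  have key : ∑ j ∈ Finset.range n, h * deMajorant a (((N + 1 + j : ℤ) : ℝ) * h) ≤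
      2 / a * (Real.exp (-(a * Real.sinh (N * h))) -
        Real.exp (-(a * Real.sinh ((N + n) * h)))) := by
    induction n with
    | zero => simp
    | succ n ih =>
      rw [Finset.sum_range_succ]
      have hx : 0 ≤ ((N : ℝ) + n) * h := by positivity
      have hcx : 1 ≤ 2 * a * Real.cosh (((N : ℝ) + n) * h) := by
        refine hc.trans (mul_le_mul_of_nonneg_left ?_ (by positivity))
        rw [Real.cosh_le_cosh, abs_of_nonneg (by positivity), abs_of_nonneg hx]
        have : (0 : ℝ) ≤ n := Nat.cast_nonneg n
        nlinarith
      have h1 := mul_deMajorant_add_le ha hx hh hcx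
      rw [show ((N : ℝ) + n) * h + h = ((N + 1 + n : ℤ) : ℝ) * h by push_cast; ring] at h1
      have e : ((N + 1 + n : ℤ) : ℝ) * h = (N + ((n + 1 : ℕ) : ℝ)) * h := by push_cast; ring
      rw [← e]
      linarith
  refine key.trans (mul_le_mul_of_nonneg_left ?_ (by positivity))
  linarith [Real.exp_pos (-(a * Real.sinh ((N + n) * h)))]

theorem xThreshold_pos {γ : ℝ} (hγ : 0 < γ) : 0 < xThreshold γ := by
  have hpi := Real.pi_pos
  unfold xThreshold
  split_ifs
  · rw [Real.arsinh_pos_iff]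
    positivity
  · rw [Real.arsinh_pos_iff]; norm_num

/-- With a = γπ/2, the last critical point of the majorant has sinh x = (1 + √(1 - 4a²))/(2a) when
2a < 1. The threshold takes a square root of the numerator and lies below it, so monotonicity is not
available. The weaker 2a cosh x ≥ 1 is what survives, and it suffices up to a factor of two. -/
theorem one_le_of_xThreshold_le {γ x : ℝ} (hγ : 0 < γ) (hx : xThreshold (γ / 2) ≤ x) :
    1 ≤ 2 * (γ * (Real.pi / 2)) * Real.cosh x := by
  have hpi := Real.pi_pos
  have hcosh := Real.one_le_cosh x
  unfold xThreshold at hx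
  split_ifs at hx with hlt
  · have h1 := Real.sinh_le_sinh.mpr hx
    rw [Real.sinh_arsinh, div_le_iff₀ (by positivity)] at h1
    have h2 : 1 ≤ √(1 + √(1 - (2 * Real.pi * (γ / 2)) ^ 2)) := by
      rw [Real.one_le_sqrt]
      linarith [Real.sqrt_nonneg (1 - (2 * Real.pi * (γ / 2)) ^ 2)]
    have h3 := mul_le_mul_of_nonneg_left (Real.sinh_lt_cosh x).le
      (by positivity : 0 ≤ 2 * Real.pi * (γ / 2))
    linarith
  · rw [not_lt, div_le_iff₀ (by positivity)] at hlt
    have h3 := mul_le_mul hlt hcosh zero_le_one (by positivity)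
    linarith

/-! ### The change of variables -/

/-- The change of variables `t = ψ(x)`. -/
theorem integrable_iff_and_integral_Iic_psi (f : ℂ → ℂ)
    (hF : Integrable fun x : ℝ => f (psi x) * deriv psi x) :
    Integrable (fun t : ℝ => f t) ∧ ∀ τ : ℝ,
      ∫ t in Iic τ, f (t : ℂ) = ∫ x in Iic (psiInv τ), f (psi (x : ℂ)) * deriv psi (x : ℂ) := by
  have hpi := Real.pi_pos
  set φ : ℝ → ℝ := fun x => Real.sinh (Real.pi / 2 * Real.sinh x) with hφ
  set φ' : ℝ → ℝ := fun x =>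
    Real.cosh (Real.pi / 2 * Real.sinh x) * (Real.pi / 2 * Real.cosh x) with hφ'
  have hd : ∀ x, HasDerivAt φ (φ' x) x := fun x =>
    ((Real.hasDerivAt_sinh x).const_mul (Real.pi / 2)).sinh
  have hmono : StrictMono φ := Real.sinh_strictMono.comp
    ((Real.sinh_strictMono).const_mul (by positivity : 0 < Real.pi / 2))
  have hψ : ∀ x : ℝ, psi x = (φ x : ℂ) := fun x => by
    simp only [psi, hφ]; push_cast; rfl
  have hφψ : ∀ τ : ℝ, φ (psiInv τ) = τ := fun τ => by
    have := psi_psiInv τ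
    rw [hψ] at this
    exact_mod_cast this
  have hψ' : ∀ x : ℝ, deriv psi x = (φ' x : ℂ) := fun x => by
    rw [(hasDerivAt_psi x).deriv]
    simp only [hφ']; push_cast; rfl
  have hpos : ∀ x, 0 < φ' x := fun x => by
    have h1 := Real.cosh_pos x
    have h2 := Real.cosh_pos (Real.pi / 2 * Real.sinh x)
    simp only [hφ']
    positivity
  have hfun : ∀ x : ℝ, |φ' x| • f (φ x : ℂ) = f (psi (x : ℂ)) * deriv psi (x : ℂ) := fun x => by
    rw [hψ, hψ', abs_of_pos (hpos x), Complex.real_smul, mul_comm]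
  constructor
  · have himage : φ '' univ = univ := by
      rw [image_univ]
      exact Set.range_eq_univ.mpr fun τ => ⟨_, hφψ τ⟩
    have := integrableOn_image_iff_integrableOn_abs_deriv_smul MeasurableSet.univ
      (fun x _ => (hd x).hasDerivWithinAt) hmono.injective.injOn (fun t : ℝ => f (t : ℂ))
    rw [himage, integrableOn_univ, integrableOn_univ] at this
    rw [this]
    simpa only [hfun] using hF
  · intro τ
    have himage : φ '' Iic (psiInv τ) = Iic τ := by
      ext t
      constructor
      · rintro ⟨x, hx, rfl⟩
        rw [mem_Iic, ← hφψ τ]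
        exact hmono.monotone hx
      · intro ht
        refine ⟨psiInv t, ?_, hφψ t⟩
        rw [mem_Iic, ← hmono.le_iff_le, hφψ, hφψ]
        exact ht
    have := integral_image_eq_integral_abs_deriv_smul measurableSet_Iic
      (fun x _ => (hd x).hasDerivWithinAt) hmono.injective.injOn (s := Iic (psiInv τ))
      (fun t : ℝ => f (t : ℂ))
    rw [himage] at this
    simpa only [hfun] using this

/-! ### Balancing truncation against discretization -/

/-- Equality holds at L = 1. In general exp(-1) - exp(-L) = exp(-1)(1 - exp(1-L)), where exp(-1) ≤
1/2 and 1 - exp(1-L) ≤ 2(1 - 1/L). -/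
theorem exp_neg_one_le_one_sub_inv_add_exp_neg {L : ℝ} (hL : 1 ≤ L) :
    Real.exp (-1) ≤ 1 - 1 / L + Real.exp (-L) := by
  have hL0 : 0 < L := by linarith
  have h2 : Real.exp (-1) ≤ 1 / 2 := by
    rw [Real.exp_neg, one_div]
    exact inv_anti₀ two_pos (by linarith [Real.add_one_le_exp (1 : ℝ)])
  have h3 : Real.exp (-L) = Real.exp (-1) * Real.exp (1 - L) := by
    rw [← Real.exp_add]; ring_nf
  have h4 : 1 - Real.exp (1 - L) ≤ 2 * (1 - 1 / L) := by
    rcases le_total L 2 with h | h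
    · have h5 := Real.add_one_le_exp (1 - L)
      have h6 : L - 1 ≤ 2 * (1 - 1 / L) := by
        have h7 : 2 * (1 - 1 / L) - (L - 1) = (L - 1) * (2 - L) / L := by
          field_simp
        have h8 : 0 ≤ (L - 1) * (2 - L) / L :=
          div_nonneg (mul_nonneg (by linarith) (by linarith)) hL0.le
        linarith
      linarith
    · have h5 : 1 / L ≤ 1 / 2 := one_div_le_one_div_of_le two_pos h
      linarith [Real.exp_pos (1 - L)]
  have h5 : 0 ≤ 1 - 1 / L := by
    rw [sub_nonneg, div_le_one hL0]; exact hL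
  rw [h3]
  nlinarith [mul_le_mul_of_nonneg_left h4 (Real.exp_pos (-1)).le,
    mul_le_mul_of_nonneg_right h2 h5]

/-- The comparison of the truncation error with the discretization error. -/
theorem truncation_le {γ μ δ y L X : ℝ} (hy : 0 < y) (hL : 1 ≤ L)
    (hyL : 4 * y = μ * Real.exp L) (hX : 0 ≤ X) (hγ0 : 0 < γ) (hγ : 4 * y ≤ γ * Real.exp X)
    (hδ : μ ≤ δ) :
    3 * y * Real.exp (-(γ * (Real.pi / 2) * Real.sinh X)) ≤
      L * Real.exp (Real.pi * (γ + δ) / 4) * Real.exp (-(Real.pi * y / L)) := by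
  have hpi := Real.pi_pos
  have hL0 : 0 < L := by linarith
  -- The loss γ/2, from exp(-X) ≤ 1 in sinh X, is what costs exp(πγ/4). The companion factor
  -- exp(πδ/4) covers the term πμ/4 = πy exp(-L) used below.
  have h1 : 2 * y - γ / 2 ≤ γ * Real.sinh X := by
    rw [Real.sinh_eq]
    have : γ * Real.exp (-X) ≤ γ * 1 :=
      mul_le_mul_of_nonneg_left (Real.exp_le_one_iff.mpr (by linarith)) hγ0.le
    linarith
  have hμe : μ = 4 * y * Real.exp (-L) := by
    rw [hyL, mul_assoc, ← Real.exp_add]; simp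
  have h2 : -(γ * (Real.pi / 2) * Real.sinh X) ≤
      -(Real.pi * y * Real.exp (-1)) + (Real.pi * (γ + δ) / 4 + -(Real.pi * y / L)) := by
    have h3 := mul_le_mul_of_nonneg_left (exp_neg_one_le_one_sub_inv_add_exp_neg hL)
      (by positivity : 0 ≤ Real.pi * y)
    have h4 := mul_le_mul_of_nonneg_left h1 (by positivity : 0 ≤ Real.pi / 2)
    have h5 : Real.pi / 4 * μ = Real.pi * y * Real.exp (-L) := by rw [hμe]; ring
    have h6 := mul_le_mul_of_nonneg_left hδ (by positivity : 0 ≤ Real.pi / 4)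
    have h7 : Real.pi * y * (1 - 1 / L + Real.exp (-L)) =
      Real.pi * y - Real.pi * y / L + Real.pi * y * Real.exp (-L) := by ring
    linarith
  -- The reserve exp(-πy/e) pays for the prefactor 3y, by t exp(-t) ≤ 1/e at t = πy/e and 3 < π.
  have h8 : 3 * y * Real.exp (-(Real.pi * y * Real.exp (-1))) ≤ L := by
    have h9 := Real.mul_exp_neg_le_exp_neg_one (Real.pi * y * Real.exp (-1))
    have h10 : Real.pi * y * Real.exp (-(Real.pi * y * Real.exp (-1))) ≤ 1 := by
      have h11 := Real.exp_pos (-1)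
      refine le_of_mul_le_mul_left ?_ h11
      linarith
    have h12 := mul_le_mul_of_nonneg_right Real.pi_gt_three.le
      (by positivity : 0 ≤ y * Real.exp (-(Real.pi * y * Real.exp (-1))))
    linarith
  calc 3 * y * Real.exp (-(γ * (Real.pi / 2) * Real.sinh X))
      ≤ 3 * y * Real.exp (-(Real.pi * y * Real.exp (-1)) +
          (Real.pi * (γ + δ) / 4 + -(Real.pi * y / L))) := by
        gcongr
    _ = 3 * y * Real.exp (-(Real.pi * y * Real.exp (-1))) *
          (Real.exp (Real.pi * (γ + δ) / 4) * Real.exp (-(Real.pi * y / L))) := by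
        rw [Real.exp_add, Real.exp_add]; ring
    _ ≤ L * (Real.exp (Real.pi * (γ + δ) / 4) * Real.exp (-(Real.pi * y / L))) := by
        gcongr
    _ = _ := by ring

/-- The floor is subtracted, so the shortened index is rounded up and both ends decay at least as
much as the slower one does at n. -/
theorem le_mul_exp_index {α β h A : ℝ} {n : ℕ} (hα : 0 < α) (hβ : 0 < β) (hh : 0 < h)
    (hA : A = min α β * Real.exp (n * h)) :
    A ≤ α * Real.exp (indexM α β h n * h) ∧ A ≤ β * Real.exp (indexN α β h n * h) := by
  have key : ∀ a b : ℝ, 0 < a → 0 < b →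
      a * Real.exp (n * h) ≤ b * Real.exp ((((n : ℤ) - ⌊Real.log (b / a) / h⌋ : ℤ) : ℝ) * h) := by
    intro a b ha hb
    have h1 : (⌊Real.log (b / a) / h⌋ : ℝ) * h ≤ Real.log (b / a) := by
      rw [← le_div_iff₀ hh]
      exact Int.floor_le _
    have h2 : n * h - Real.log (b / a) ≤ (((n : ℤ) - ⌊Real.log (b / a) / h⌋ : ℤ) : ℝ) * h := by
      push_cast
      linarith
    calc a * Real.exp (n * h) = b * Real.exp (n * h - Real.log (b / a)) := by
          rw [Real.exp_sub, Real.exp_log (by positivity)]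
          field_simp
      _ ≤ _ := by gcongr
  unfold indexM indexN
  split_ifs with hm
  · rw [hm] at hA
    rw [hA]
    exact ⟨by push_cast; exact le_rfl, key α β hα hβ⟩
  · have hm' : min α β = β := by
      rcases min_choice α β with h | h
      · exact absurd h hm
      · exact h
    rw [hm'] at hA
    rw [hA]
    exact ⟨key β α hβ hα, by push_cast; exact le_rfl⟩

theorem two_rpow_div_le {γ μ ν : ℝ} (hμ : 0 < μ) (hμγ : μ ≤ γ) (hγν : γ ≤ ν) :
    (2 : ℝ) ^ γ / γ ≤ 2 ^ ν / μ :=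
  div_le_div₀ (by positivity) (Real.rpow_le_rpow_of_exponent_le one_le_two hγν) hμ hμγ

/-- One of the two tails of the truncated sum. -/
theorem sum_tail_le {f : ℂ → ℂ} {K γ h : ℝ} (hK : 0 ≤ K) (hγ : 0 < γ) (hh : 0 < h) {N : ℤ}
    (hNh : xThreshold (γ / 2) ≤ N * h) (σ : ℤ) (hσ : |(σ : ℝ)| = 1)
    (hf : ∀ k : ℤ, N < k → ‖f (psi (((σ * k : ℤ) * h : ℝ) : ℂ))‖ ≤
      K * ‖E1 (psi (((σ * k : ℤ) * h : ℝ) : ℂ)) γ‖) (x : ℝ) (n : ℕ) :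
    ∑ j ∈ Finset.range n, ‖f (psi (((σ * (N + 1 + j) : ℤ) * h : ℝ) : ℂ)) *
        deriv psi (((σ * (N + 1 + j) : ℤ) * h : ℝ) : ℂ) *
          (J (σ * (N + 1 + j)) h x : ℂ)‖ ≤
      3 * K * (2 ^ γ / γ) * Real.exp (-(γ * (Real.pi / 2) * Real.sinh (N * h))) := by
  have hpi := Real.pi_pos
  have hNpos : 0 < (N : ℝ) * h := (xThreshold_pos (by positivity)).trans_le hNh
  have hN : 0 ≤ N := by
    have : (0 : ℝ) < N := pos_of_mul_pos_left hNpos hh.le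
    exact_mod_cast this.le
  -- The sign σ = ±1 selects the right or left tail; it disappears because the majorant is even.
  have hterm : ∀ k : ℤ, N < k → ‖f (psi (((σ * k : ℤ) * h : ℝ) : ℂ)) *
      deriv psi (((σ * k : ℤ) * h : ℝ) : ℂ) * (J (σ * k) h x : ℂ)‖ ≤
      K * (Real.pi / 2) * 2 ^ γ * (3 / 2) * (h * deMajorant (γ * (Real.pi / 2)) (k * h)) := by
    intro k hk
    have h1 := norm_comp_psi_mul_deriv_le hK hγ.le (ζ := (((σ * k : ℤ) * h : ℝ) : ℂ))
      (by rw [Complex.ofReal_im, abs_zero]; positivity) (hf k hk)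
    rw [Complex.ofReal_re, Complex.ofReal_im, Real.cos_zero, Real.sin_zero, mul_zero,
      Real.cos_zero, Real.one_rpow, div_one, mul_one] at h1
    have h2 : K * (Real.pi / 2) * Real.cosh ((σ * k : ℤ) * h) *
        (2 ^ γ * Real.exp (-(γ * (Real.pi / 2) * |Real.sinh ((σ * k : ℤ) * h)|))) =
        K * (Real.pi / 2) * 2 ^ γ * deMajorant (γ * (Real.pi / 2)) (k * h) := by
      have h3 : deMajorant (γ * (Real.pi / 2)) (k * h) =
          deMajorant (γ * (Real.pi / 2)) ((σ * k : ℤ) * h) := by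
        rw [← deMajorant_abs, ← deMajorant_abs _ (((σ * k : ℤ) : ℝ) * h)]
        push_cast
        rw [mul_assoc, abs_mul (σ : ℝ), hσ, one_mul]
      rw [h3, deMajorant]
      ring
    rw [h2] at h1
    have h4 : ‖(J (σ * k) h x : ℂ)‖ ≤ 3 / 2 * h := by
      rw [Complex.norm_real]
      exact abs_J_le _ hh x
    rw [norm_mul]
    refine (mul_le_mul h1 h4 (norm_nonneg _) ((norm_nonneg _).trans h1)).trans (le_of_eq ?_)
    ring
  calc _ ≤ ∑ j ∈ Finset.range n, K * (Real.pi / 2) * 2 ^ γ * (3 / 2) *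
        (h * deMajorant (γ * (Real.pi / 2)) (((N + 1 + j : ℤ) : ℝ) * h)) :=
        Finset.sum_le_sum fun j _ => hterm (N + 1 + j) (by omega)
    -- The final 3 is 3/2 from the bound on J times 2 from the near-monotonicity; the factors π/2
    -- cancel.
    _ ≤ K * (Real.pi / 2) * 2 ^ γ * (3 / 2) * (2 / (γ * (Real.pi / 2)) *
        Real.exp (-(γ * (Real.pi / 2) * Real.sinh (N * h)))) := by
        rw [← Finset.mul_sum]
        refine mul_le_mul_of_nonneg_left ?_ (by positivity)
        exact sum_deMajorant_le (by positivity) hh hN (one_le_of_xThreshold_le hγ hNh) n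
    _ = _ := by
        field_simp

end SincDE

/-! ### Assembling the error bound -/

theorem theorem3p4
    (d : ℝ) (hd0 : 0 < d) (hd : d < Real.pi / 2)
    (f : ℂ → ℂ) (hf : AnalyticOnNhd ℂ f (SincDE.psi '' SincDE.strip d))
    (K α β : ℝ) (hK : 0 < K) (hα : 0 < α) (hβ : 0 < β)
    (hneg : ∀ z ∈ SincDE.psi '' SincDE.stripNeg d, ‖f z‖ ≤ K * ‖SincDE.E1 z α‖)
    (hpos : ∀ z ∈ SincDE.psi '' SincDE.stripPos d, ‖f z‖ ≤ K * ‖SincDE.E1 z β‖)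
    (μ ν : ℝ) (hμ : μ = min α β) (hν : ν = max α β)
    (n : ℕ) (h : ℝ) (hh : h = Real.log (4 * d * n / μ) / n)
    (M N : ℤ) (hM : M = SincDE.indexM α β h n) (hN : N = SincDE.indexN α β h n)
    (hn : ν * Real.exp 1 / (4 * d) ≤ n)
    (hMh : SincDE.xThreshold (α / 2) ≤ M * h)
    (hNh : SincDE.xThreshold (β / 2) ≤ N * h) :
    MeasureTheory.Integrable (fun t : ℝ => f (t : ℂ)) ∧
      ∀ τ : ℝ,
        ‖(∫ t in Set.Iic τ, f (t : ℂ)) -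
            ∑ k ∈ Finset.Icc (-M) N,
              f (SincDE.psi ((k * h : ℝ) : ℂ)) * deriv SincDE.psi ((k * h : ℝ) : ℂ) *
                (SincDE.J k h (SincDE.psiInv τ) : ℂ)‖ ≤
          SincDE.C1 K d α β * SincDE.rate d μ n := by
  have hpi := Real.pi_pos
  have hμ0 : 0 < μ := by rw [hμ]; exact lt_min hα hβ
  have hμα : μ ≤ α := by rw [hμ]; exact min_le_left _ _
  have hμβ : μ ≤ β := by rw [hμ]; exact min_le_right _ _
  have hαν : α ≤ ν := by rw [hν]; exact le_max_left _ _
  have hβν : β ≤ ν := by rw [hν]; exact le_max_right _ _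
  have hn0 : (0 : ℝ) < n := lt_of_lt_of_le (by have := hμ0.trans_le (hμα.trans hαν); positivity) hn
  set L := Real.log (4 * d * n / μ) with hL
  have hq0 : 0 < 4 * d * n / μ := by positivity
  have hexpL : Real.exp L = 4 * d * n / μ := Real.exp_log hq0
  -- The lower bound on n says 4dn ≥ νe ≥ μe.
  have hL1 : 1 ≤ L := by
    rw [hL, Real.le_log_iff_exp_le hq0, le_div_iff₀ hμ0]
    rw [div_le_iff₀ (by positivity)] at hn
    have := mul_le_mul_of_nonneg_right (hμα.trans hαν) (Real.exp_pos 1).le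
    linarith
  have hL0 : 0 < L := by linarith
  have hh0 : 0 < h := by rw [hh]; positivity
  have hnh : n * h = L := by rw [hh]; field_simp
  set F : ℂ → ℂ := fun ζ => f (SincDE.psi ζ) * deriv SincDE.psi ζ with hF
  set a := μ * (Real.pi / 2 * Real.cos d) with ha
  have hcosd : 0 < Real.cos d := Real.cos_pos_of_mem_Ioo ⟨by linarith, hd⟩
  have hqd := SincDE.cos_half_pi_mul_sin_pos (y := d) (by rwa [abs_of_pos hd0])
  have ha0 : 0 < a := by positivity
  set Q := Real.cos (Real.pi / 2 * Real.sin d) ^ ν with hQ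
  have hQ0 : 0 < Q := Real.rpow_pos_of_pos hqd _
  set C := K * (Real.pi / 2) * 2 ^ ν / Q with hC
  have hboundα : ∀ ζ ∈ SincDE.strip d, ζ.re < 0 →
      ‖f (SincDE.psi ζ)‖ ≤ K * ‖SincDE.E1 (SincDE.psi ζ) α‖ :=
    fun ζ hζ hre => hneg _ ⟨ζ, ⟨hζ, hre⟩, rfl⟩
  have hboundβ : ∀ ζ ∈ SincDE.strip d, 0 ≤ ζ.re →
      ‖f (SincDE.psi ζ)‖ ≤ K * ‖SincDE.E1 (SincDE.psi ζ) β‖ :=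
    fun ζ hζ hre => hpos _ ⟨ζ, ⟨hζ, hre⟩, rfl⟩
  have hFg : ∀ ζ ∈ SincDE.strip d, ‖F ζ‖ ≤ C * SincDE.deMajorant a ζ.re := by
    intro ζ hζ
    rcases lt_or_ge ζ.re 0 with hre | hre
    · exact SincDE.norm_comp_psi_mul_deriv_le_strip hK.le hμ0 hμα hαν hd hζ (hboundα ζ hζ hre)
    · exact SincDE.norm_comp_psi_mul_deriv_le_strip hK.le hμ0 hμβ hβν hd hζ (hboundβ ζ hζ hre)
  have hFd : ∀ ζ ∈ SincDE.strip d, DifferentiableAt ℂ F ζ := by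
    intro ζ hζ
    have h1 : DifferentiableAt ℂ (deriv SincDE.psi) ζ := by
      have : deriv SincDE.psi = fun ζ => Complex.cosh ((Real.pi / 2 : ℂ) * Complex.sinh ζ) *
          ((Real.pi / 2 : ℂ) * Complex.cosh ζ) := funext fun ζ => (SincDE.hasDerivAt_psi ζ).deriv
      rw [this]
      fun_prop
    exact ((hf _ ⟨ζ, hζ, rfl⟩).differentiableAt.comp ζ
      (SincDE.hasDerivAt_psi ζ).differentiableAt).mul h1
  have hreal : ∀ x : ℝ, (x : ℂ) ∈ SincDE.strip d := fun x => by
    change |(x : ℂ).im| < d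
    rwa [Complex.ofReal_im, abs_zero]
  have hFr : ∀ x : ℝ, ‖F x‖ ≤ C * SincDE.deMajorant a x := fun x => by
    have := hFg x (hreal x)
    rwa [Complex.ofReal_re] at this
  have hgi := (SincDE.integrable_deMajorant ha0).const_mul C
  have hgs := (SincDE.summable_deMajorant ha0 hh0).mul_left C
  have hFc : Continuous fun x : ℝ => F x := continuous_iff_continuousAt.mpr fun x =>
    (hFd x (hreal x)).continuousAt.comp Complex.continuous_ofReal.continuousAt
  have hFi : MeasureTheory.Integrable fun x : ℝ => F x :=
    hgi.mono' hFc.aestronglyMeasurable (MeasureTheory.ae_of_all _ hFr)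
  obtain ⟨hfi, hfI⟩ := SincDE.integrable_iff_and_integral_Iic_psi f hFi
  refine ⟨hfi, fun τ => ?_⟩
  rw [hfI τ]
  set ξ := SincDE.psiInv τ
  have hdisc := SincDE.norm_integral_Iic_sub_tsum_J_le_strip hh0 hd0 hFd hFg hgi
    (by simpa using (SincDE.tendsto_deMajorant ha0).const_mul C) hgs ξ
  have hMpos : 0 < (M : ℝ) * h := (SincDE.xThreshold_pos (by positivity)).trans_le hMh
  have hNpos : 0 < (N : ℝ) * h := (SincDE.xThreshold_pos (by positivity)).trans_le hNh
  -- Positive thresholds force M, N > 0, so the nodes of each tail have a definite sign and only one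
  -- of the two growth hypotheses applies.
  have hM0 : 0 < M := by exact_mod_cast pos_of_mul_pos_left hMpos hh0.le
  have hN0 : 0 < N := by exact_mod_cast pos_of_mul_pos_left hNpos hh0.le
  have hsum : Summable fun k : ℤ => F ((k * h : ℝ) : ℂ) * (SincDE.J k h ξ : ℂ) := by
    refine Summable.of_norm_bounded (hgs.mul_right (3 / 2 * h)) fun k => ?_
    rw [norm_mul, Complex.norm_real]
    exact mul_le_mul (hFr _) (SincDE.abs_J_le k hh0 ξ) (norm_nonneg _)
      ((norm_nonneg _).trans (hFr _))
  have htrunc := SincDE.norm_tsum_sub_sum_Icc_le hsum (M := M) (N := N) (by omega)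
    (fun m => by
      have := SincDE.sum_tail_le (f := f) hK.le hβ hh0 hNh 1 (by simp) (fun k hk => by
        refine hboundβ _ (hreal _) ?_
        rw [Complex.ofReal_re, one_mul]
        have : (0 : ℝ) < k := by exact_mod_cast hN0.trans hk
        positivity) ξ m
      simpa only [one_mul] using this)
    (fun m => by
      have := SincDE.sum_tail_le (f := f) hK.le hα hh0 hMh (-1) (by simp) (fun k hk => by
        refine hboundα _ (hreal _) ?_
        rw [Complex.ofReal_re]
        have : (0 : ℝ) < k := by exact_mod_cast hM0.trans hk
        have := mul_pos this hh0
        push_cast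
        linarith) ξ m
      simpa only [neg_one_mul] using this)
  obtain ⟨hMe, hNe⟩ := SincDE.le_mul_exp_index (A := 4 * (d * n)) (n := n) hα hβ hh0 (by
    rw [hnh, hexpL, ← hμ]; field_simp)
  rw [← hM] at hMe
  rw [← hN] at hNe
  have hyL : 4 * (d * n) = μ * Real.exp L := by rw [hexpL]; field_simp
  have hT1 := SincDE.truncation_le (by positivity) hL1 hyL hNpos.le hβ hNe hμα
  have hT2 := SincDE.truncation_le (by positivity) hL1 hyL hMpos.le hα hMe hμβ
  rw [add_comm β α] at hT1
  set R := Real.exp (-(Real.pi * (d * n) / L)) with hR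
  set G := Real.exp (Real.pi * (α + β) / 4) with hG
  have htail : ∀ γ X : ℝ, 0 < γ → μ ≤ γ → γ ≤ ν →
      3 * (d * n) * Real.exp (-(γ * (Real.pi / 2) * Real.sinh X)) ≤ L * G * R →
      3 * K * (2 ^ γ / γ) * Real.exp (-(γ * (Real.pi / 2) * Real.sinh X)) ≤
        K * 2 ^ ν / (μ * d) * (G * (R * L / n)) := by
    intro γ X hγ h1 h2 h3
    have h4 := SincDE.two_rpow_div_le hμ0 h1 h2
    have h5 : 3 * Real.exp (-(γ * (Real.pi / 2) * Real.sinh X)) ≤ L * G * R / (d * n) := by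
      rw [le_div_iff₀ (by positivity)]
      linarith
    calc 3 * K * (2 ^ γ / γ) * Real.exp (-(γ * (Real.pi / 2) * Real.sinh X))
        = K * (2 ^ γ / γ) * (3 * Real.exp (-(γ * (Real.pi / 2) * Real.sinh X))) := by ring
      _ ≤ K * (2 ^ ν / μ) * (L * G * R / (d * n)) := by gcongr
      _ = _ := by field_simp
  have hTβ := htail β _ hβ hμβ hβν hT1
  have hTα := htail α _ hα hμα hαν hT2
  have hdh : Real.pi * d / h = Real.pi * (d * n) / L := by
    rw [hh]; field_simp
  have hE0 : 0 < 1 - Real.exp (-(Real.pi * μ * Real.exp 1 / 2)) := by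
    rw [sub_pos, Real.exp_lt_one_iff]
    have : 0 < Real.pi * μ * Real.exp 1 / 2 := by positivity
    linarith
  -- With t = πdn/L, 1/sinh t = 2exp(-t)/(1 - exp(-2t)). From 4dn = μ exp(L) ≥ μeL follows 2t ≥
  -- πμe/2, which makes the denominator independent of n.
  have hsinh : (Real.sinh (Real.pi * d / h))⁻¹ ≤
      2 * R / (1 - Real.exp (-(Real.pi * μ * Real.exp 1 / 2))) := by
    have h1 : Real.pi * μ * Real.exp 1 / 2 ≤ 2 * (Real.pi * (d * n) / L) := by
      have h2 : Real.exp 1 * L ≤ Real.exp L := by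
        have h3 := Real.add_one_le_exp (L - 1)
        have h4 := mul_le_mul_of_nonneg_left h3 (Real.exp_pos 1).le
        rw [← Real.exp_add] at h4
        simpa using h4
      rw [← mul_div_assoc, le_div_iff₀ hL0]
      have h5 := mul_le_mul_of_nonneg_left h2 (by positivity : 0 ≤ Real.pi * μ / 2)
      have h6 : Real.pi * μ / 2 * Real.exp L = 2 * (Real.pi * (d * n)) := by
        rw [mul_div_assoc, mul_comm μ] at *
        linear_combination -(Real.pi / 2) * hyL
      linarith
    have h7 : Real.sinh (Real.pi * d / h) = (1 - Real.exp (-(2 * (Real.pi * (d * n) / L)))) /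
        (2 * R) := by
      rw [hdh, Real.sinh_eq, hR, eq_div_iff (by positivity)]
      have e1 : Real.exp (Real.pi * (d * n) / L) * Real.exp (-(Real.pi * (d * n) / L)) = 1 := by
        rw [← Real.exp_add]; simp
      have e2 : Real.exp (-(2 * (Real.pi * (d * n) / L))) =
          Real.exp (-(Real.pi * (d * n) / L)) * Real.exp (-(Real.pi * (d * n) / L)) := by
        rw [← Real.exp_add]; ring_nf
      rw [e2]
      linear_combination e1
    rw [h7, inv_div]
    have h8 : Real.exp (-(2 * (Real.pi * (d * n) / L))) ≤
        Real.exp (-(Real.pi * μ * Real.exp 1 / 2)) := by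
      rw [Real.exp_le_exp]; linarith
    refine div_le_div_of_nonneg_left (by positivity) hE0 (by linarith)
  have hD : (∫ t, C * SincDE.deMajorant a t) / Real.pi *
      ((Real.sinh (Real.pi * d / h))⁻¹ * (h / d)) ≤
      2 * (K * 2 ^ ν / (μ * d)) * (1 / ((1 - Real.exp (-(Real.pi * μ * Real.exp 1 / 2))) * Q *
        Real.cos d) * (R * L / n)) := by
    rw [MeasureTheory.integral_const_mul, SincDE.integral_deMajorant ha0]
    have h1 : (0 : ℝ) < 2 ^ ν := by positivity
    generalize 1 - Real.exp (-(Real.pi * μ * Real.exp 1 / 2)) = E at hsinh hE0 ⊢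
    calc C * (2 / a) / Real.pi * ((Real.sinh (Real.pi * d / h))⁻¹ * (h / d))
        ≤ C * (2 / a) / Real.pi * (2 * R / E * (h / d)) := by
          have : 0 < C := by positivity
          gcongr
      _ = 2 / Real.pi * (2 * (K * 2 ^ ν / (μ * d)) * (1 / (E * Q * Real.cos d) * (R * L / n))) := by
          rw [hC, ha, hh]
          field_simp
      _ ≤ 1 * (2 * (K * 2 ^ ν / (μ * d)) * (1 / (E * Q * Real.cos d) * (R * L / n))) := by
          have h2 : 2 / Real.pi ≤ 1 := by
            rw [div_le_one hpi]; linarith [Real.pi_gt_three]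
          gcongr
      _ = _ := one_mul _
  -- The extra 2 in 2^(ν+1) counts the two tails in the truncation part; in the discretization part
  -- it covers the factor 4/π obtained above.
  have hfinal : SincDE.C1 K d α β * SincDE.rate d μ n =
      2 * (K * 2 ^ ν / (μ * d)) * (1 / ((1 - Real.exp (-(Real.pi * μ * Real.exp 1 / 2))) * Q *
        Real.cos d) * (R * L / n)) + 2 * (K * 2 ^ ν / (μ * d) * (G * (R * L / n))) := by
    rw [SincDE.C1, SincDE.rate, ← hμ, ← hν, ← hL, ← hG, ← hQ, Real.rpow_add two_pos, Real.rpow_one,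
      hR, mul_assoc Real.pi d (n : ℝ)]
    ring
  rw [hfinal]
  refine (norm_sub_le_norm_sub_add_norm_sub _
    (∑' k : ℤ, F ((k * h : ℝ) : ℂ) * (SincDE.J k h ξ : ℂ)) _).trans ?_
  linarith [hdisc, htrunc, hD, hTα, hTβ]
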